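/- Let $n\in\mathbb N$, $s\in\mathbb R$, $0<p<\infty$, $0<q\le\infty$ and $-n<\varrho<0$. *Notation.* Let $\varphi_0\in S(\mathbb R^n)$ be any function with $\varphi_0(x)=1$ for $|x|\le 1$ and $\varphi_0(x)=0$ for $|x|\ge 3/2$, and let $\varphi_k(x)=\varphi_0(2^{-k}x)-\varphi_0(2^{-k+1}x)$ for $k\in\mathbb N$. For $f\in S'(\mathbb R^n)$ let $f_j=(\varphi_j\widehat f)^\vee$, $j\in\mathbb N_0$, where $\widehat{\varphi}(\xi)=(2\pi)^{-n/2}\int_{\mathbb R^n}e^{-ix\xi}\varphi(x)\,dx$ on $S(\mathbb R^n)$ (extended to $S'(\mathbb R^n)$ by duality); $f_j$ is an entire analytic function. For $J\in\mathbb Z$ and $M\in\mathbb Z^n$ let $Q_{J,M}=2^{-J}M+2^{-J}(0,1)^n$, let $J^+=\max(J,0)$, and for measurable $g$ let $$\|g\,|\,\Lambda^\varrho_p\|=\sup_{J\in\mathbb Z,\,M\in\mathbb Z^n}2^{\frac Jp(n+\varrho)}\Big(\int_{Q_{J,M}}|g(x)|^p\,dx\Big)^{1/p}.$$ The members of the $\varrho$-clan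 $\varrho\text{-}A^s_{p,q}(\mathbb R^n)$ with parameters $s,p,q$ are the spaces $\Lambda_\varrho B^s_{p,q}(\mathbb R^n)$, $\Lambda_\varrho F^s_{p,q}(\mathbb R^n)$, $\Lambda^\varrho B^s_{p,q}(\mathbb R^n)$ and $\Lambda^\varrho F^s_{p,q}(\mathbb R^n)$ of all $f\in S'(\mathbb R^n)$ for which, respectively, $$\Big(\sum_{j=0}^\infty 2^{jsq}\,\big\|f_j\,|\,\Lambda^\varrho_p\big\|^q\Big)^{1/q},\qquad \Big\|\Big(\sum_{j=0}^\infty 2^{jsq}|f_j(\cdot)|^q\Big)^{1/q}\Big|\,\Lambda^\varrho_p\Big\|,$$ $$\sup_{J\in\mathbb Z,\,M\in\mathbb Z^n}2^{\frac Jp(n+\varrho)}\Big(\sum_{j\ge J^+}2^{jsq}\,\big\|f_j\,|\,L_p(Q_{J,M})\big\|^q\Big)^{1/q},\qquad \sup_{J\in\mathbb Z,\,M\in\mathbb Z^n}2^{\frac Jp(n+\varrho)}\Big\|\Big(\sum_{j\ge J^+}2^{jsq}|f_j(\cdot)|^q\Big)^{1/q}\Big|\,L_p(Q_{J,M})\Big\|$$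 is finite (with the supremum over $j$ in place of the sum if $q=\infty$). A set $A\subset S'(\mathbb R^n)$ is said to be contained in $L_1^{\mathrm{loc}}(\mathbb R^n)$ if for every $f\in A$ there is a locally integrable function $g$ on $\mathbb R^n$ with $f(\psi)=\int_{\mathbb R^n}g(x)\psi(x)\,dx$ for all $\psi\in C_0^\infty(\mathbb R^n)$. Finally, let $\sigma^{|\varrho|}_p=|\varrho|\big(\max(\tfrac1p,1)-1\big)$. **Theorem 5.7.** If $s>\sigma^{|\varrho|}_p$, then each of the four spaces of the $\varrho$-clan with parameters $s,p,q$ is contained in $L_1^{\mathrm{loc}}(\mathbb R^n)$. If $s<\sigma^{|\varrho|}_p$, then none of these four spaces is contained in $L_1^{\mathrm{loc}}(\mathbb R^n)$. -/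

import Mathlib

open MeasureTheory SchwartzMap FourierTransform
open scoped ENNReal

namespace MorreySmoothness

noncomputable section

/-- The Euclidean space `ℝⁿ`. -/
abbrev E (n : ℕ) : Type := EuclideanSpace ℝ (Fin n)

/-- The Schwartz function `x ↦ φ (c x)`, for `c ≠ 0`. -/
def dilate {n : ℕ} (c : ℝ) (hc : c ≠ 0) (φ : 𝓢(E n, ℂ)) : 𝓢(E n, ℂ) :=
  SchwartzMap.compCLMOfContinuousLinearEquiv ℂ
    (ContinuousLinearEquiv.smulLeft (Units.mk0 c hc) : E n ≃L[ℝ] E n) φ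

theorem dilate_apply {n : ℕ} (c : ℝ) (hc : c ≠ 0) (φ : 𝓢(E n, ℂ)) (x : E n) :
    dilate c hc φ x = φ (c • x) := rfl

/-- `φ₀` generates a dyadic resolution of unity:
`φ₀ (x) = 1` if `|x| ≤ 1` and `φ₀ (x) = 0` if `|x| ≥ 3/2`. -/
structure IsGenerator {n : ℕ} (φ₀ : 𝓢(E n, ℂ)) : Prop where
  eq_one : ∀ x, ‖x‖ ≤ 1 → φ₀ x = 1
  eq_zero : ∀ x, 3 / 2 ≤ ‖x‖ → φ₀ x = 0

/-- The dyadic resolution of unity generated by `φ₀`: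
`φ_k (x) = φ₀ (2^{-k} x) - φ₀ (2^{-k+1} x)` for `k ≥ 1`. -/
def resolution {n : ℕ} (φ₀ : 𝓢(E n, ℂ)) : ℕ → 𝓢(E n, ℂ)
  | 0 => φ₀
  | k + 1 => dilate ((2 : ℝ)⁻¹ ^ (k + 1)) (by positivity) φ₀
      - dilate ((2 : ℝ)⁻¹ ^ k) (by positivity) φ₀

/-- The functions `φ_j` in the frequency variable of Mathlib's Fourier transform.
Mathlib uses the kernel `e^{-2πi⟨x, η⟩}`; in terms of the transform with kernel `e^{-i⟨x, ξ⟩}`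
and factor `(2π)^{-n/2}` one has `ξ = 2πη`, so that multiplication by `φ_j (ξ)` there is
multiplication by `φ_j (2πη)` here. -/
def symbol {n : ℕ} (φ₀ : 𝓢(E n, ℂ)) (j : ℕ) : 𝓢(E n, ℂ) :=
  dilate (2 * Real.pi) (by positivity) (resolution φ₀ j)

/-- The entire analytic function `x ↦ (φ_j f^)^∨ (x)` of a tempered distribution `f`, that is, the
convolution of `f` with the Schwartz function `K = 𝓕⁻ (symbol φ₀ j)`:
the distribution `f` is applied to `y ↦ K (x - y) = 𝓕 (symbol φ₀ j) (y - x)`. -/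
def block {n : ℕ} (φ₀ : 𝓢(E n, ℂ)) (f : 𝓢'(E n, ℂ)) (j : ℕ) (x : E n) : ℂ :=
  f (SchwartzMap.compSubConstCLM ℂ x (𝓕 (symbol φ₀ j)))

/-- The `ℓ_q` quasi-norm of a sequence, `0 < q ≤ ∞`. -/
def lqNorm (q : ℝ≥0∞) (a : ℕ → ℝ≥0∞) : ℝ≥0∞ :=
  if q = ∞ then ⨆ j, a j else (∑' j, a j ^ q.toReal) ^ (1 / q.toReal)

/-- The `L_p` quasi-norm over the set `A`, `0 < p < ∞`, of a function given through its modulus. -/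
def lpNormOn {n : ℕ} (p : ℝ) (A : Set (E n)) (g : E n → ℝ≥0∞) : ℝ≥0∞ :=
  (∫⁻ x in A, g x ^ p) ^ (1 / p)

/-- The dyadic cube `Q_{J,M} = 2^{-J} M + 2^{-J} (0,1)ⁿ`. -/
def dyadicCube {n : ℕ} (J : ℤ) (M : Fin n → ℤ) : Set (E n) :=
  {x | ∀ i, (2 : ℝ) ^ (-J) * M i < x i ∧ x i < (2 : ℝ) ^ (-J) * (M i + 1)}

/-- The Morrey weight `2^{(J/p)(n+ϱ)}`. -/
def morreyWeight (n : ℕ) (ϱ p : ℝ) (J : ℤ) : ℝ≥0∞ :=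
  (2 : ℝ≥0∞) ^ ((J : ℝ) / p * ((n : ℝ) + ϱ))

/-- The quasi-norm of the Morrey space `Λ^ϱ_p (ℝⁿ)`, of a function given through its modulus. -/
def morreyNorm {n : ℕ} (ϱ p : ℝ) (g : E n → ℝ≥0∞) : ℝ≥0∞ :=
  ⨆ (J : ℤ) (M : Fin n → ℤ), morreyWeight n ϱ p J * lpNormOn p (dyadicCube J M) g

/-- `2^{js} |(φ_j f^)^∨ (x)|`. -/
def wblock {n : ℕ} (φ₀ : 𝓢(E n, ℂ)) (s : ℝ) (f : 𝓢'(E n, ℂ)) (j : ℕ) (x : E n) : ℝ≥0∞ :=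
  (2 : ℝ≥0∞) ^ ((j : ℝ) * s) * ‖block φ₀ f j x‖ₑ

/-- The terms of a sequence with index `j ≥ J⁺ = max (J, 0)`; the other ones are replaced by `0`. -/
def tail (J : ℤ) (a : ℕ → ℝ≥0∞) (j : ℕ) : ℝ≥0∞ :=
  if max J 0 ≤ (j : ℤ) then a j else 0

/-- The quasi-norm of `Λ_ϱ B^s_{p,q} (ℝⁿ)`. -/
def lowerBNorm {n : ℕ} (φ₀ : 𝓢(E n, ℂ)) (ϱ s p : ℝ) (q : ℝ≥0∞) (f : 𝓢'(E n, ℂ)) : ℝ≥0∞ :=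
  lqNorm q (fun j => morreyNorm ϱ p (wblock φ₀ s f j))

/-- The quasi-norm of `Λ_ϱ F^s_{p,q} (ℝⁿ)`. -/
def lowerFNorm {n : ℕ} (φ₀ : 𝓢(E n, ℂ)) (ϱ s p : ℝ) (q : ℝ≥0∞) (f : 𝓢'(E n, ℂ)) : ℝ≥0∞ :=
  morreyNorm ϱ p (fun x => lqNorm q (fun j => wblock φ₀ s f j x))

/-- The quasi-norm of `Λ^ϱ B^s_{p,q} (ℝⁿ)`. -/
def upperBNorm {n : ℕ} (φ₀ : 𝓢(E n, ℂ)) (ϱ s p : ℝ) (q : ℝ≥0∞) (f : 𝓢'(E n, ℂ)) : ℝ≥0∞ :=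
  ⨆ (J : ℤ) (M : Fin n → ℤ), morreyWeight n ϱ p J *
    lqNorm q (tail J (fun j => lpNormOn p (dyadicCube J M) (wblock φ₀ s f j)))

/-- The quasi-norm of `Λ^ϱ F^s_{p,q} (ℝⁿ)`. -/
def upperFNorm {n : ℕ} (φ₀ : 𝓢(E n, ℂ)) (ϱ s p : ℝ) (q : ℝ≥0∞) (f : 𝓢'(E n, ℂ)) : ℝ≥0∞ :=
  ⨆ (J : ℤ) (M : Fin n → ℤ), morreyWeight n ϱ p J *
    lpNormOn p (dyadicCube J M) (fun x => lqNorm q (tail J (fun j => wblock φ₀ s f j x)))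

/-- The space `Λ_ϱ B^s_{p,q} (ℝⁿ)`. -/
def lowerB (n : ℕ) (φ₀ : 𝓢(E n, ℂ)) (ϱ s p : ℝ) (q : ℝ≥0∞) : Set 𝓢'(E n, ℂ) :=
  {f | lowerBNorm φ₀ ϱ s p q f < ∞}

/-- The space `Λ_ϱ F^s_{p,q} (ℝⁿ)`. -/
def lowerF (n : ℕ) (φ₀ : 𝓢(E n, ℂ)) (ϱ s p : ℝ) (q : ℝ≥0∞) : Set 𝓢'(E n, ℂ) :=
  {f | lowerFNorm φ₀ ϱ s p q f < ∞}

/-- The space `Λ^ϱ B^s_{p,q} (ℝⁿ)`. -/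
def upperB (n : ℕ) (φ₀ : 𝓢(E n, ℂ)) (ϱ s p : ℝ) (q : ℝ≥0∞) : Set 𝓢'(E n, ℂ) :=
  {f | upperBNorm φ₀ ϱ s p q f < ∞}

/-- The space `Λ^ϱ F^s_{p,q} (ℝⁿ)`. -/
def upperF (n : ℕ) (φ₀ : 𝓢(E n, ℂ)) (ϱ s p : ℝ) (q : ℝ≥0∞) : Set 𝓢'(E n, ℂ) :=
  {f | upperFNorm φ₀ ϱ s p q f < ∞}

/-- The members `ϱ-A^s_{p,q} (ℝⁿ)`, with fixed `s`, `p`, `q`, of the `ϱ`-clan. -/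
def clan (n : ℕ) (φ₀ : 𝓢(E n, ℂ)) (ϱ s p : ℝ) (q : ℝ≥0∞) : Set (Set 𝓢'(E n, ℂ)) :=
  {lowerB n φ₀ ϱ s p q, upperB n φ₀ ϱ s p q, lowerF n φ₀ ϱ s p q, upperF n φ₀ ϱ s p q}

/-- The tempered distributions that belong to `L_1^loc (ℝⁿ)`, that is, which are represented by a
locally integrable function when applied to test functions in `C_0^∞ (ℝⁿ)`. -/
def L1loc (n : ℕ) : Set 𝓢'(E n, ℂ) :=
  {f | ∃ g : E n → ℂ, LocallyIntegrable g volume ∧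
      ∀ φ : 𝓢(E n, ℂ), HasCompactSupport φ → f φ = ∫ x, g x * φ x}

/-- `σ^t_p = t (max (1/p, 1) - 1)`. -/
def sigma (t p : ℝ) : ℝ := t * (max (1 / p) 1 - 1)

end

end MorreySmoothness

/-!
The critical smoothness `σ = |ϱ| (max (1/p, 1) - 1)` is the loss in passing from the Morrey
quasi-norm of the blocks `f_j` to their `L_1` norms over unit cubes.

*Above `σ`.* All four quasi-norms dominate `2^{js} 2^{(J/p)(n+ϱ)} ‖f_j | L_p(Q_{J,M})‖` for `j ≥
J⁺` (`exists_local_bound`). For `p ≥ 1` this bounds the `L_1` norms of `f_j` over unit cubes by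
`2^{-js}`. For `p < 1`, the block `f_j` is reproduced by convolution with a kernel of scale `2⁻ʲ`,
so that `sup |f_j|^p` is controlled by the `L_p` norms over the cubes of side length `2⁻ʲ`
(`enorm_rpow_le_of_reproducing`); interpolating `|f_j| ≤ (sup |f_j|)^{1-p} |f_j|^p` gives the
bound `2^{-j(s-σ)}` (`exists_lintegral_block_le`). Hence `∑ f_j` converges in a weighted `L_1`
space, and its sum represents `f` because `∑ f_j = f` as distributions
(`mem_L1loc_of_tsum_ne_top`). The latter, like the reproducing formula, rests on
`apply_convolution`: a tempered distribution commutes with the integral of a convolution. This is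
proved by extending the distribution to a Banach space of bounded functions by the Hahn-Banach
theorem and using the Bochner integral there.

*Below `σ`.* One distribution lies in all four spaces without being locally integrable. Its block
of index `j` has frequencies near a point `c_j` with `2π |c_j| = 7/8 * 2^j`, and is the average of
wave packets of width `2⁻ʲ` centred at the points of a grid of mesh size `1 / N_j` in the unit
cube (`packetSum`). With `N_j = 2^j` for `p ≥ 1`, and `N_j` about `2^{j(n+ϱ)/n}` for `p < 1`,
which is the sparsest grid that is evenly distributed in the sense of the Morrey condition,
counting grid points in cubes yields the Morrey norm `≲ 2^{-jσ}` (`exists_morreyNorm_block_le`).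
Such a geometric gain over `2^{-js}` puts the distribution into all four spaces
(`mem_of_morreyNorm_block_le`). On the other hand the pairing with `e^{-2πi⟨c_j, ·⟩} ψ`, where `ψ`
is a cut-off function of the unit cube, tends to `1`, whereas it would tend to `0` by the
Riemann-Lebesgue lemma if the distribution were locally integrable
(`notMem_L1loc_of_fourier_eq_packetSum`).
-/

namespace MorreySmoothness

variable {n : ℕ}

/-! ### Translations of Schwartz functions and tempered distributions -/

/-- A tempered distribution is bounded by finitely many Schwartz seminorms. -/
theorem exists_seminorm_bound (f : 𝓢'(E n, ℂ)) :
    ∃ (N : ℕ) (C : ℝ), 0 ≤ C ∧ ∀ φ : 𝓢(E n, ℂ),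
      ‖f φ‖ ≤ C * (Finset.Iic (N, N)).sup (schwartzSeminormFamily ℂ (E n) ℂ) φ := by
  obtain ⟨s, C, -, hC⟩ := Seminorm.bound_of_continuous (schwartz_withSeminorms ℂ (E n) ℂ)
    ((normSeminorm ℂ ℂ).comp f.toLinearMap) (by
      change Continuous fun φ => ‖f φ‖
      exact (map_continuous f).norm)
  obtain ⟨N, hN⟩ : ∃ N : ℕ, s ⊆ Finset.Iic (N, N) := by
    refine ⟨s.sup (α := ℕ) fun m : ℕ × ℕ => max m.1 m.2, fun m hm => ?_⟩
    have : max m.1 m.2 ≤ s.sup (α := ℕ) fun m : ℕ × ℕ => max m.1 m.2 :=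
      Finset.le_sup (f := fun m : ℕ × ℕ => max m.1 m.2) hm
    simp only [Finset.mem_Iic, Prod.le_def]
    exact ⟨(le_max_left _ _).trans this, (le_max_right _ _).trans this⟩
  refine ⟨N, C, C.2, fun φ => ?_⟩
  refine (hC φ).trans ?_
  change (C : ℝ) * _ ≤ _
  gcongr
  exact Seminorm.le_def.1 (Finset.sup_mono hN) φ

theorem iteratedFDeriv_translate (κ : 𝓢(E n, ℂ)) (l : ℕ) (x y : E n) :
    iteratedFDeriv ℝ l (compSubConstCLM ℂ x κ) y = iteratedFDeriv ℝ l κ (y - x) := by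
  have : (compSubConstCLM ℂ x κ : E n → ℂ) = fun y => κ (y - x) := rfl
  rw [this, iteratedFDeriv_comp_sub]

theorem exists_weighted_bound (κ : 𝓢(E n, ℂ)) (k l : ℕ) :
    ∃ M : ℝ, 0 ≤ M ∧ ∀ x y w : E n, ‖y‖ ≤ (1 + ‖x‖) * (1 + ‖w‖) →
      ‖y‖ ^ k * ‖iteratedFDeriv ℝ l κ w‖ ≤ M * (1 + ‖x‖) ^ k := by
  refine ⟨2 ^ k * (Finset.Iic (k, l)).sup (fun m => SchwartzMap.seminorm ℂ m.1 m.2) κ,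
    by positivity, fun x y w h => ?_⟩
  calc ‖y‖ ^ k * ‖iteratedFDeriv ℝ l κ w‖
    _ ≤ ((1 + ‖x‖) * (1 + ‖w‖)) ^ k * ‖iteratedFDeriv ℝ l κ w‖ := by gcongr
    _ = (1 + ‖w‖) ^ k * ‖iteratedFDeriv ℝ l κ w‖ * (1 + ‖x‖) ^ k := by rw [mul_pow]; ring
    _ ≤ _ := mul_le_mul_of_nonneg_right
      (one_add_le_sup_seminorm_apply (𝕜 := ℂ) (m := (k, l)) le_rfl le_rfl κ w) (by positivity)

/-- Translation is locally Lipschitz in each weighted `C^l` norm. -/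
theorem exists_translate_lipschitz (κ : 𝓢(E n, ℂ)) (k l : ℕ) :
    ∃ M : ℝ, 0 ≤ M ∧ ∀ x z y : E n, ‖x - z‖ ≤ 1 →
      ‖y‖ ^ k * ‖iteratedFDeriv ℝ l κ (y - x) - iteratedFDeriv ℝ l κ (y - z)‖
        ≤ M * (1 + ‖x‖) ^ k * ‖x - z‖ := by
  obtain ⟨M, hM, h⟩ := exists_weighted_bound κ k (l + 1)
  refine ⟨M, hM, fun x z y hxz => ?_⟩
  have hd : Differentiable ℝ (iteratedFDeriv ℝ l κ) :=
    (κ.smooth (l + 1 : ℕ)).differentiable_iteratedFDeriv (by norm_cast; simp)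
  have key := (convex_segment (y - z) (y - x)).norm_image_sub_le_of_norm_fderiv_le
    (𝕜 := ℝ) (f := fun w => (‖y‖ ^ k) • iteratedFDeriv ℝ l κ w) (C := M * (1 + ‖x‖) ^ k)
    (fun w _ => (hd w).fun_const_smul _) (fun w hw => ?_)
    (left_mem_segment ℝ (y - z) (y - x)) (right_mem_segment ℝ (y - z) (y - x))
  · rw [← smul_sub, norm_smul, norm_pow, norm_norm] at key
    refine key.trans_eq ?_
    rw [show y - x - (y - z) = -(x - z) by abel, norm_neg]
  · rw [fderiv_fun_const_smul (hd w), norm_smul, norm_pow, norm_norm, norm_fderiv_iteratedFDeriv]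
    refine h x y w ?_
    have h1 : ‖(y - x) - w‖ ≤ ‖x - z‖ := by
      obtain ⟨a, b, ha, hb, hab, rfl⟩ := hw
      have : (y - x) - (a • (y - z) + b • (y - x)) = -(a • (x - z)) := by
        obtain rfl : b = 1 - a := by linarith
        module
      rw [this, norm_neg, norm_smul, Real.norm_of_nonneg ha]
      have : a ≤ 1 := by linarith
      nlinarith [norm_nonneg (x - z)]
    have h2 : ‖y‖ ≤ ‖(y - x) - w‖ + ‖w‖ + ‖x‖ := by
      calc ‖y‖ = ‖((y - x) - w) + w + x‖ := by congr 1; abel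
        _ ≤ _ := norm_add₃_le
    nlinarith [norm_nonneg x, norm_nonneg w]

theorem norm_iteratedFDeriv_apply_le {F : Type*} [NormedAddCommGroup F] [NormedSpace ℝ F] {l : ℕ}
    (T : E n [×l]→L[ℝ] F) (m : Fin l → Metric.closedBall (0 : E n) 1) :
    ‖T fun j => (m j : E n)‖ ≤ ‖T‖ := by
  refine (T.le_opNorm _).trans (mul_le_of_le_one_right (norm_nonneg _) ?_)
  exact Finset.prod_le_one (fun _ _ => norm_nonneg _) fun j _ => mem_closedBall_zero_iff.1 (m j).2

theorem opNorm_le_of_forall_closedBall {F : Type*} [NormedAddCommGroup F] [NormedSpace ℝ F] {l : ℕ}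
    (T : E n [×l]→L[ℝ] F) {C : ℝ} (hC : 0 ≤ C)
    (h : ∀ m : Fin l → Metric.closedBall (0 : E n) 1, ‖T fun j => (m j : E n)‖ ≤ C) : ‖T‖ ≤ C := by
  refine T.opNorm_le_bound hC fun m => ?_
  have hm : ∀ j, ‖m j‖⁻¹ • m j ∈ Metric.closedBall (0 : E n) 1 := fun j => by
    rw [mem_closedBall_zero_iff, norm_smul, norm_inv, norm_norm]
    exact inv_mul_le_one
  have h1 : m = fun j => ‖m j‖ • (‖m j‖⁻¹ • m j) := by
    ext1 j
    by_cases h0 : m j = 0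
    · simp [h0]
    · rw [smul_smul, mul_inv_cancel₀ (norm_ne_zero_iff.2 h0), one_smul]
  have h2 : T m = (∏ j, ‖m j‖) • T fun j => ‖m j‖⁻¹ • m j := by
    conv_lhs => rw [h1]
    exact T.map_smul_univ _ _
  rw [h2, norm_smul, Real.norm_of_nonneg (Finset.prod_nonneg fun _ _ => norm_nonneg _), mul_comm]
  gcongr
  exact h fun j => ⟨_, hm j⟩

/-- The data at which the Schwartz seminorms of indices at most `(N, N)` test a function: the
indices `(k, l)` of a seminorm, a point of space and `l` directions in the unit ball. -/
structure SeminormIndex (n N : ℕ) where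
  /-- The exponent of the weight. -/
  k : ℕ
  /-- The order of differentiation. -/
  l : ℕ
  mem : (k, l) ∈ Finset.Iic (N, N)
  /-- The point of evaluation. -/
  pt : E n
  /-- The directions of differentiation. -/
  dir : Fin l → Metric.closedBall (0 : E n) 1

instance (N : ℕ) : TopologicalSpace (SeminormIndex n N) := ⊥

instance (N : ℕ) : DiscreteTopology (SeminormIndex n N) := ⟨rfl⟩

/-- The value `‖y‖^k D^l φ(y) m` of a weighted derivative of `φ` that belongs to an index. -/
noncomputable def weightedDeriv {N : ℕ} (a : SeminormIndex n N) (φ : 𝓢(E n, ℂ)) : ℂ :=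
  ((‖a.pt‖ ^ a.k : ℝ) : ℂ) * iteratedFDeriv ℝ a.l φ a.pt fun j => (a.dir j : E n)

theorem norm_weightedDeriv {N : ℕ} (a : SeminormIndex n N) (φ : 𝓢(E n, ℂ)) :
    ‖weightedDeriv a φ‖ =
      ‖a.pt‖ ^ a.k * ‖iteratedFDeriv ℝ a.l φ a.pt fun j => (a.dir j : E n)‖ := by
  rw [weightedDeriv, norm_mul, Complex.norm_real, norm_pow, norm_norm]

theorem norm_weightedDeriv_le {N : ℕ} (a : SeminormIndex n N) (φ : 𝓢(E n, ℂ)) :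
    ‖weightedDeriv a φ‖ ≤ ‖a.pt‖ ^ a.k * ‖iteratedFDeriv ℝ a.l φ a.pt‖ := by
  rw [norm_weightedDeriv]
  gcongr
  exact norm_iteratedFDeriv_apply_le _ _

theorem norm_weightedDeriv_le_seminorm {N : ℕ} (a : SeminormIndex n N) (φ : 𝓢(E n, ℂ)) :
    ‖weightedDeriv a φ‖ ≤ (Finset.Iic (N, N)).sup (schwartzSeminormFamily ℂ (E n) ℂ) φ :=
  calc _ ≤ ‖a.pt‖ ^ a.k * ‖iteratedFDeriv ℝ a.l φ a.pt‖ := norm_weightedDeriv_le a φ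
    _ ≤ SchwartzMap.seminorm ℂ a.k a.l φ := φ.le_seminorm ℂ _ _ _
    _ ≤ _ := Seminorm.le_def.1 (Finset.le_sup (f := schwartzSeminormFamily ℂ (E n) ℂ) a.mem) φ

theorem weightedDeriv_add {N : ℕ} (a : SeminormIndex n N) (φ ψ : 𝓢(E n, ℂ)) :
    weightedDeriv a (φ + ψ) = weightedDeriv a φ + weightedDeriv a ψ := by
  have : iteratedFDeriv ℝ a.l (φ + ψ : 𝓢(E n, ℂ)) a.pt = iteratedFDeriv ℝ a.l φ a.pt
      + iteratedFDeriv ℝ a.l ψ a.pt :=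
    iteratedFDeriv_add_apply (φ.smooth _).contDiffAt (ψ.smooth _).contDiffAt
  rw [weightedDeriv, this, add_apply, mul_add]
  rfl

theorem weightedDeriv_smul {N : ℕ} (a : SeminormIndex n N) (c : ℂ) (φ : 𝓢(E n, ℂ)) :
    weightedDeriv a (c • φ) = c * weightedDeriv a φ := by
  have : iteratedFDeriv ℝ a.l (c • φ : 𝓢(E n, ℂ)) a.pt = c • iteratedFDeriv ℝ a.l φ a.pt :=
    iteratedFDeriv_const_smul_apply (φ.smooth _).contDiffAt
  rw [weightedDeriv, this, smul_apply, smul_eq_mul, mul_left_comm]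
  rfl

theorem weightedDeriv_translate {N : ℕ} (a : SeminormIndex n N) (κ : 𝓢(E n, ℂ)) (x : E n) :
    weightedDeriv a (compSubConstCLM ℂ x κ) =
      ((‖a.pt‖ ^ a.k : ℝ) : ℂ) * iteratedFDeriv ℝ a.l κ (a.pt - x) fun j => (a.dir j : E n) := by
  rw [weightedDeriv, iteratedFDeriv_translate]

/-- The embedding of the Schwartz space into a Banach space of bounded functions that realizes the
Schwartz seminorms of indices at most `(N, N)`. -/
noncomputable def seminormEmbedding (N : ℕ) :
    𝓢(E n, ℂ) →ₗ[ℂ] BoundedContinuousFunction (SeminormIndex n N) ℂ where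
  toFun φ := BoundedContinuousFunction.ofNormedAddCommGroupDiscrete (fun a => weightedDeriv a φ)
    _ fun a => norm_weightedDeriv_le_seminorm a φ
  map_add' φ ψ := by
    ext1 a
    exact weightedDeriv_add a φ ψ
  map_smul' c φ := by
    ext1 a
    exact weightedDeriv_smul a c φ

theorem seminormEmbedding_apply {N : ℕ} (φ : 𝓢(E n, ℂ)) (a : SeminormIndex n N) :
    seminormEmbedding N φ a = weightedDeriv a φ := rfl

theorem sup_seminorm_le_norm_seminormEmbedding (N : ℕ) (φ : 𝓢(E n, ℂ)) :
    (Finset.Iic (N, N)).sup (schwartzSeminormFamily ℂ (E n) ℂ) φ ≤ ‖seminormEmbedding N φ‖ := by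
  refine Seminorm.finset_sup_apply_le (norm_nonneg _) fun i hi => ?_
  refine φ.seminorm_le_bound ℂ i.1 i.2 (norm_nonneg _) fun y => ?_
  have h : ‖(‖y‖ ^ i.1) • iteratedFDeriv ℝ i.2 φ y‖ ≤ ‖seminormEmbedding N φ‖ := by
    refine opNorm_le_of_forall_closedBall _ (norm_nonneg _) fun m => ?_
    have := (seminormEmbedding N φ).norm_coe_le_norm ⟨i.1, i.2, hi, y, m⟩
    rw [seminormEmbedding_apply, norm_weightedDeriv] at this
    rwa [smul_apply, norm_smul, norm_pow, norm_norm]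
  rwa [norm_smul, norm_pow, norm_norm] at h

theorem seminormEmbedding_injective (N : ℕ) :
    Function.Injective (seminormEmbedding (n := n) N) := by
  refine (injective_iff_map_eq_zero _).2 fun φ hφ => ?_
  have h := sup_seminorm_le_norm_seminormEmbedding N φ
  rw [hφ, norm_zero] at h
  have h0 : SchwartzMap.seminorm ℂ 0 0 φ ≤ 0 := by
    refine le_trans ?_ h
    exact Seminorm.le_def.1 (Finset.le_sup (f := schwartzSeminormFamily ℂ (E n) ℂ)
      (b := (0, 0)) (by simp [Prod.le_def])) φ
  ext x
  have := (φ.norm_le_seminorm ℂ x).trans h0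
  simpa using this

/-- Hahn–Banach: a tempered distribution factors through some `seminormEmbedding N`. -/
theorem exists_extension_seminormEmbedding (f : 𝓢'(E n, ℂ)) :
    ∃ (N : ℕ) (F : StrongDual ℂ (BoundedContinuousFunction (SeminormIndex n N) ℂ)),
      ∀ φ, F (seminormEmbedding N φ) = f φ := by
  obtain ⟨N, C, hC, hf⟩ := exists_seminorm_bound f
  let e := LinearEquiv.ofInjective _ (seminormEmbedding_injective (n := n) N)
  let F₀ : StrongDual ℂ (LinearMap.range (seminormEmbedding (n := n) N)) :=
    LinearMap.mkContinuous (f.toLinearMap ∘ₗ e.symm.toLinearMap) C (fun v => by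
      obtain ⟨φ, rfl⟩ := e.surjective v
      simp only [LinearMap.comp_apply, LinearEquiv.coe_coe, LinearEquiv.symm_apply_apply]
      refine (hf φ).trans ?_
      gcongr
      exact sup_seminorm_le_norm_seminormEmbedding N φ)
  obtain ⟨F, hF, -⟩ := exists_extension_norm_eq _ F₀
  refine ⟨N, F, fun φ => ?_⟩
  have := hF (e φ)
  refine this.trans ?_
  change f (e.symm (e φ)) = f φ
  rw [e.symm_apply_apply]

theorem continuous_seminormEmbedding_translate (N : ℕ) (κ : 𝓢(E n, ℂ)) :
    Continuous fun x => seminormEmbedding N (compSubConstCLM ℂ x κ) := by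
  choose M hM h using exists_translate_lipschitz κ
  rw [continuous_iff_continuousAt]
  intro x
  rw [ContinuousAt, tendsto_iff_norm_sub_tendsto_zero]
  set C := ∑ i ∈ Finset.Iic ((N, N) : ℕ × ℕ), M i.1 i.2 with hCdef
  have hC : 0 ≤ C := Finset.sum_nonneg fun i _ => hM _ _
  have hlim : Filter.Tendsto (fun z => C * (1 + ‖x‖) ^ N * ‖x - z‖) (nhds x) (nhds 0) := by
    have : Continuous fun z => C * (1 + ‖x‖) ^ N * ‖x - z‖ := by fun_prop
    simpa using this.tendsto x
  refine squeeze_zero' (Filter.Eventually.of_forall fun _ => norm_nonneg _) ?_ hlim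
  filter_upwards [Metric.ball_mem_nhds x one_pos] with z hz
  have hz' : ‖x - z‖ ≤ 1 := by rw [← dist_eq_norm, dist_comm]; exact (Metric.mem_ball.1 hz).le
  refine (BoundedContinuousFunction.norm_le (by positivity)).2 fun a => ?_
  rw [BoundedContinuousFunction.sub_apply, seminormEmbedding_apply, seminormEmbedding_apply,
    weightedDeriv_translate, weightedDeriv_translate, ← mul_sub,
    ← sub_apply, norm_mul, Complex.norm_real, norm_pow, norm_norm]
  have h1 : (1 : ℝ) ≤ 1 + ‖x‖ := by linarith [norm_nonneg x]
  have hi : a.k ≤ N := (Finset.mem_Iic.1 a.mem).1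
  calc _ ≤ ‖a.pt‖ ^ a.k *
        ‖iteratedFDeriv ℝ a.l κ (a.pt - z) - iteratedFDeriv ℝ a.l κ (a.pt - x)‖ := by
        gcongr; exact norm_iteratedFDeriv_apply_le _ _
    _ ≤ M a.k a.l * (1 + ‖x‖) ^ a.k * ‖x - z‖ := by
        rw [norm_sub_rev]; exact h _ _ x z a.pt hz'
    _ ≤ _ := by
        gcongr
        exact Finset.single_le_sum (f := fun i : ℕ × ℕ => M i.1 i.2) (fun i _ => hM _ _) a.mem

theorem exists_norm_seminormEmbedding_translate_le (N : ℕ) (κ : 𝓢(E n, ℂ)) :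
    ∃ C : ℝ, 0 ≤ C ∧ ∀ x,
      ‖seminormEmbedding N (compSubConstCLM ℂ x κ)‖ ≤ C * (1 + ‖x‖) ^ N := by
  choose M hM h using exists_weighted_bound κ
  have hC : 0 ≤ ∑ i ∈ Finset.Iic ((N, N) : ℕ × ℕ), M i.1 i.2 := Finset.sum_nonneg fun i _ => hM _ _
  refine ⟨_, hC, fun x => ?_⟩
  refine (BoundedContinuousFunction.norm_le (by positivity)).2 fun a => ?_
  rw [seminormEmbedding_apply]
  refine (norm_weightedDeriv_le _ _).trans ?_
  rw [iteratedFDeriv_translate]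
  have h2 : ‖a.pt‖ ≤ (1 + ‖x‖) * (1 + ‖a.pt - x‖) := by
    have := norm_add_le (a.pt - x) x
    rw [sub_add_cancel] at this
    nlinarith [norm_nonneg x, norm_nonneg (a.pt - x)]
  have hi : a.k ≤ N := (Finset.mem_Iic.1 a.mem).1
  have h1 : (1 : ℝ) ≤ 1 + ‖x‖ := by linarith [norm_nonneg x]
  refine (h _ _ x a.pt (a.pt - x) h2).trans ?_
  gcongr
  exact Finset.single_le_sum (f := fun i : ℕ × ℕ => M i.1 i.2) (fun i _ => hM _ _) a.mem

theorem continuous_translate_apply (f : 𝓢'(E n, ℂ)) (κ : 𝓢(E n, ℂ)) :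
    Continuous fun x => f (compSubConstCLM ℂ x κ) := by
  obtain ⟨N, F, hF⟩ := exists_extension_seminormEmbedding f
  simp_rw [← hF]
  exact F.continuous.comp (continuous_seminormEmbedding_translate N κ)

/-- The regularization `x ↦ f (κ (· - x))` of a tempered distribution grows polynomially, with an
exponent that depends on `f` only. -/
theorem exists_translate_growth (f : 𝓢'(E n, ℂ)) :
    ∃ N : ℕ, ∀ κ : 𝓢(E n, ℂ), ∃ C : ℝ, 0 ≤ C ∧ ∀ x,
      ‖f (compSubConstCLM ℂ x κ)‖ ≤ C * (1 + ‖x‖) ^ N := by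
  obtain ⟨N, F, hF⟩ := exists_extension_seminormEmbedding f
  refine ⟨N, fun κ => ?_⟩
  obtain ⟨C, hC, h⟩ := exists_norm_seminormEmbedding_translate_le N κ
  refine ⟨‖F‖ * C, by positivity, fun x => ?_⟩
  rw [← hF]
  refine (F.le_opNorm _).trans ?_
  rw [mul_assoc]
  gcongr
  exact h x

theorem integrable_one_add_norm_pow_mul (ψ : 𝓢(E n, ℂ)) (N : ℕ) :
    Integrable fun x => (1 + ‖x‖) ^ N * ‖ψ x‖ := by
  refine Integrable.mono' (g := fun x => 2 ^ (N - 1) * (‖x‖ ^ 0 * ‖ψ x‖ + ‖x‖ ^ N * ‖ψ x‖))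
    (((ψ.integrable_pow_mul volume 0).add (ψ.integrable_pow_mul volume N)).const_mul _)
    (by fun_prop) (Filter.Eventually.of_forall fun x => ?_)
  rw [Real.norm_of_nonneg (by positivity)]
  have := add_pow_le (zero_le_one (α := ℝ)) (norm_nonneg x) N
  calc (1 + ‖x‖) ^ N * ‖ψ x‖ ≤ (2 ^ (N - 1) * (1 ^ N + ‖x‖ ^ N)) * ‖ψ x‖ := by gcongr
    _ = _ := by simp; ring

open LineDeriv

theorem integrable_mul_translate (ψ χ : 𝓢(E n, ℂ)) (w : E n) :
    Integrable fun x => ψ x * χ (w - x) := by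
  refine ((ψ.integrable (μ := volume)).norm.mul_const (SchwartzMap.seminorm ℝ 0 0 χ)).mono'
    (by fun_prop) (Filter.Eventually.of_forall fun x => ?_)
  rw [norm_mul]
  gcongr
  exact χ.norm_le_seminorm ℝ _

theorem hasDerivAt_comp_line (κ : 𝓢(E n, ℂ)) (v w : E n) (t : ℝ) :
    HasDerivAt (fun t : ℝ => κ (w + t • v)) ((∂_{v} κ) (w + t • v)) t := by
  rw [SchwartzMap.lineDerivOp_apply_eq_fderiv]
  have h1 : HasDerivAt (fun t : ℝ => w + t • v) v t := by
    simpa using ((hasDerivAt_id t).smul_const v).const_add w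
  exact (κ.hasFDerivAt (w + t • v)).comp_hasDerivAt t h1

/-- Differentiation under the integral sign in a convolution of two Schwartz functions. -/
theorem lineDerivOp_convolution {ψ κ θ : 𝓢(E n, ℂ)} (hθ : ∀ y, θ y = ∫ x, ψ x * κ (y - x))
    (v y : E n) : (∂_{v} θ) y = ∫ x, ψ x * (∂_{v} κ) (y - x) := by
  let F : ℝ → E n → ℂ := fun t x => ψ x * κ (y + t • v - x)
  let F' : ℝ → E n → ℂ := fun t x => ψ x * (∂_{v} κ) (y + t • v - x)
  have hF : ∀ t, Integrable (F t) := fun t => integrable_mul_translate ψ κ _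
  have hF' : Integrable (F' 0) := integrable_mul_translate ψ (∂_{v} κ) _
  have hbound : ∀ x t, ‖F' t x‖ ≤ ‖ψ x‖ * SchwartzMap.seminorm ℝ 0 0 (∂_{v} κ) := fun x t => by
    change ‖ψ x * (∂_{v} κ) (y + t • v - x)‖ ≤ _
    rw [norm_mul]
    gcongr
    exact (∂_{v} κ).norm_le_seminorm ℝ _
  have hdiff : ∀ x t, HasDerivAt (fun t => F t x) (F' t x) t := fun x t => by
    have := (hasDerivAt_comp_line κ v (y - x) t).const_mul (ψ x)
    simp only [sub_add_eq_add_sub] at this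
    exact this
  have hb : Integrable fun x => ‖ψ x‖ * SchwartzMap.seminorm ℝ 0 0 (∂_{v} κ) :=
    (ψ.integrable (μ := volume)).norm.mul_const _
  have key : HasDerivAt (fun t : ℝ => ∫ x, F t x) (∫ x, F' 0 x) 0 :=
    (hasDerivAt_integral_of_dominated_loc_of_deriv_le (𝕜 := ℝ) (s := Set.univ) Filter.univ_mem
      (Filter.Eventually.of_forall fun t => (hF t).1) (hF 0) hF'.1
      (Filter.Eventually.of_forall fun x t _ => hbound x t) hb
      (Filter.Eventually.of_forall fun x t _ => hdiff x t)).2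
  have h2 : HasDerivAt (fun t : ℝ => θ (y + t • v)) ((∂_{v} θ) (y + (0 : ℝ) • v)) 0 :=
    hasDerivAt_comp_line θ v y 0
  have h3 : (fun t : ℝ => θ (y + t • v)) = fun t : ℝ => ∫ x, F t x :=
    funext fun t => hθ _
  rw [h3] at h2
  have h4 := h2.unique key
  simpa only [F', zero_smul, add_zero] using h4

theorem iteratedFDeriv_convolution {ψ κ θ : 𝓢(E n, ℂ)} (hθ : ∀ y, θ y = ∫ x, ψ x * κ (y - x))
    (l : ℕ) (m : Fin l → E n) (y : E n) :
    iteratedFDeriv ℝ l θ y m = ∫ x, ψ x * iteratedFDeriv ℝ l κ (y - x) m := by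
  simp_rw [← SchwartzMap.iteratedLineDerivOp_eq_iteratedFDeriv]
  induction l generalizing y with
  | zero => simpa using hθ y
  | succ l ih =>
    simp_rw [iteratedLineDerivOp_succ_left]
    exact lineDerivOp_convolution (ih (Fin.tail m)) (m 0) y

/-- A tempered distribution can be moved under the integral sign of a convolution: if
`θ = ψ ∗ κ`, then `f θ = ∫ ψ(x) f (κ (· - x)) dx`. -/
theorem apply_convolution (f : 𝓢'(E n, ℂ)) {ψ κ θ : 𝓢(E n, ℂ)}
    (hθ : ∀ y, θ y = ∫ x, ψ x * κ (y - x)) :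
    f θ = ∫ x, ψ x * f (compSubConstCLM ℂ x κ) := by
  obtain ⟨N, F, hF⟩ := exists_extension_seminormEmbedding f
  obtain ⟨C, hC, h⟩ := exists_norm_seminormEmbedding_translate_le N κ
  set Φ := fun x => ψ x • seminormEmbedding N (compSubConstCLM ℂ x κ) with hΦdef
  have hΦ : Integrable Φ := by
    refine ((integrable_one_add_norm_pow_mul ψ N).const_mul C).mono'
      ((ψ.continuous.smul (continuous_seminormEmbedding_translate N κ)).aestronglyMeasurable)
      (Filter.Eventually.of_forall fun x => ?_)
    rw [hΦdef, norm_smul]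
    calc _ ≤ ‖ψ x‖ * (C * (1 + ‖x‖) ^ N) := by gcongr; exact h x
      _ = _ := by ring
  -- The identity in the Banach space is checked by evaluation at each index.
  have key : ∫ x, Φ x = seminormEmbedding N θ := by
    ext1 a
    have h1 := (BoundedContinuousFunction.evalCLM ℂ a).integral_comp_comm hΦ
    refine h1.symm.trans ?_
    rw [seminormEmbedding_apply, weightedDeriv, iteratedFDeriv_convolution hθ, ← integral_const_mul]
    congr 1
    ext1 x
    change ψ x * weightedDeriv a (compSubConstCLM ℂ x κ) = _
    rw [weightedDeriv, iteratedFDeriv_translate, mul_left_comm]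
  rw [← hF θ, ← key, ← F.integral_comp_comm hΦ]
  congr 1
  ext1 x
  rw [hΦdef, map_smul, hF, smul_eq_mul]

/-! ### Fourier transforms of Schwartz functions -/

theorem fourier_dilate (c : ℝ) (hc : 0 < c) (φ : 𝓢(E n, ℂ)) (x : E n) :
    𝓕 (dilate c hc.ne' φ) x = ((c⁻¹ ^ n : ℝ) : ℂ) * 𝓕 φ (c⁻¹ • x) := by
  rw [SchwartzMap.fourier_coe, SchwartzMap.fourier_coe, Real.fourier_eq', Real.fourier_eq']
  have h := Measure.integral_comp_smul_of_nonneg (volume : Measure (E n))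
    (fun v => Complex.exp (↑(-2 * Real.pi * inner ℝ v (c⁻¹ • x)) * Complex.I) • φ v) c
    (hR := hc.le)
  rw [finrank_euclideanSpace_fin, Complex.real_smul, ← inv_pow] at h
  rw [← h]
  congr 1
  ext1 v
  rw [dilate_apply, inner_smul_left, inner_smul_right, RCLike.conj_to_real,
    mul_inv_cancel_left₀ hc.ne']

theorem fourierInv_translate (g : 𝓢(E n, ℂ)) (x η : E n) :
    𝓕⁻ (compSubConstCLM ℂ x g) η
      = Complex.exp (↑(2 * Real.pi * inner ℝ x η) * Complex.I) * 𝓕⁻ g η := by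
  rw [SchwartzMap.fourierInv_coe, SchwartzMap.fourierInv_coe, Real.fourierInv_eq',
    Real.fourierInv_eq', ← integral_const_mul, ← integral_add_right_eq_self _ x]
  congr 1
  ext1 v
  rw [compSubConstCLM_apply, add_sub_cancel_right, smul_eq_mul, smul_eq_mul, ← mul_assoc,
    ← Complex.exp_add, inner_add_left]
  congr 2
  push_cast
  ring

theorem fourier_translate (g : 𝓢(E n, ℂ)) (x η : E n) :
    𝓕 (compSubConstCLM ℂ x g) η
      = Complex.exp (↑(-2 * Real.pi * inner ℝ x η) * Complex.I) * 𝓕 g η := by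
  rw [SchwartzMap.fourier_coe, SchwartzMap.fourier_coe, Real.fourier_eq',
    Real.fourier_eq', ← integral_const_mul, ← integral_add_right_eq_self _ x]
  congr 1
  ext1 v
  rw [compSubConstCLM_apply, add_sub_cancel_right, smul_eq_mul, smul_eq_mul, ← mul_assoc,
    ← Complex.exp_add, inner_add_left]
  congr 2
  push_cast
  ring

/-- The pointwise product of two Schwartz functions. -/
noncomputable def schwartzMul (a b : 𝓢(E n, ℂ)) : 𝓢(E n, ℂ) :=
  pairing (ContinuousLinearMap.mul ℂ ℂ) a b

theorem schwartzMul_apply (a b : 𝓢(E n, ℂ)) (x : E n) : schwartzMul a b x = a x * b x := rfl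

theorem fourier_fourier_neg (a : 𝓢(E n, ℂ)) (x : E n) : 𝓕 (𝓕 a) (-x) = a x := by
  have h : 𝓕⁻ (𝓕 a) x = a x := by rw [FourierTransform.fourierInv_fourier_eq]
  rwa [SchwartzMap.fourierInv_coe, Real.fourierInv_eq_fourier_neg] at h

/-- The Fourier transform of a product is the convolution of the Fourier transforms. -/
theorem fourier_mul_eq_convolution (a b : 𝓢(E n, ℂ)) (y : E n) :
    𝓕 (schwartzMul a b) y = ∫ x, 𝓕 a x * 𝓕 b (y - x) := by
  have h := SchwartzMap.convolution_apply (ContinuousLinearMap.mul ℂ ℂ) (𝓕 a) (𝓕 b) y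
  have h1 : 𝓕 (schwartzMul a b) y
      = SchwartzMap.convolution (ContinuousLinearMap.mul ℂ ℂ) (𝓕 a) (𝓕 b) y := by
    change _ = 𝓕⁻ (pairing (ContinuousLinearMap.mul ℂ ℂ) (𝓕 (𝓕 a)) (𝓕 (𝓕 b))) y
    rw [SchwartzMap.fourierInv_coe, Real.fourierInv_eq_fourier_comp_neg, SchwartzMap.fourier_coe]
    refine congrArg (fun h : E n → ℂ => 𝓕 h y) (funext fun x => ?_)
    change a x * b x = 𝓕 (𝓕 a) (-x) * 𝓕 (𝓕 b) (-x)
    rw [fourier_fourier_neg, fourier_fourier_neg]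
  rw [h1, h]
  rfl

theorem exists_one_add_norm_bound (κ : 𝓢(E n, ℂ)) (N : ℕ) :
    ∃ C : ℝ, 0 ≤ C ∧ ∀ x, ‖κ x‖ ≤ C * ((1 + ‖x‖) ^ N)⁻¹ := by
  refine ⟨2 ^ N * (Finset.Iic (N, 0)).sup (fun m => SchwartzMap.seminorm ℂ m.1 m.2) κ,
    by positivity, fun x => ?_⟩
  have h := one_add_le_sup_seminorm_apply (𝕜 := ℂ) (m := (N, 0)) le_rfl le_rfl κ x
  rw [norm_iteratedFDeriv_zero] at h
  rw [← div_eq_mul_inv, le_div_iff₀ (by positivity), mul_comm]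
  exact h

/-! ### The dyadic resolution of unity -/

/-- The sum of the symbols of index at most `N`. -/
noncomputable def lowpass (φ₀ : 𝓢(E n, ℂ)) (N : ℕ) : 𝓢(E n, ℂ) :=
  dilate (2 * Real.pi) (by positivity) (dilate ((2 : ℝ)⁻¹ ^ N) (by positivity) φ₀)

theorem lowpass_apply (φ₀ : 𝓢(E n, ℂ)) (N : ℕ) (x : E n) :
    lowpass φ₀ N x = φ₀ ((2 : ℝ)⁻¹ ^ N • (2 * Real.pi) • x) := rfl

theorem symbol_zero_apply (φ₀ : 𝓢(E n, ℂ)) (x : E n) :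
    symbol φ₀ 0 x = φ₀ ((2 * Real.pi) • x) := rfl

theorem symbol_succ_apply (φ₀ : 𝓢(E n, ℂ)) (k : ℕ) (x : E n) :
    symbol φ₀ (k + 1) x = φ₀ ((2 : ℝ)⁻¹ ^ (k + 1) • (2 * Real.pi) • x)
      - φ₀ ((2 : ℝ)⁻¹ ^ k • (2 * Real.pi) • x) := rfl

theorem sum_symbol (φ₀ : 𝓢(E n, ℂ)) (N : ℕ) :
    ∑ j ∈ Finset.range (N + 1), symbol φ₀ j = lowpass φ₀ N := by
  induction N with
  | zero =>
    ext x
    simp [lowpass_apply, symbol_zero_apply]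
  | succ N ih =>
    rw [Finset.sum_range_succ, ih]
    ext x
    rw [add_apply, symbol_succ_apply, lowpass_apply, lowpass_apply]
    ring

theorem lowpass_eq_dilate (φ₀ : 𝓢(E n, ℂ)) (N : ℕ) :
    lowpass φ₀ N = dilate ((2 : ℝ)⁻¹ ^ N) (by positivity) (lowpass φ₀ 0) := by
  ext x
  rw [dilate_apply, lowpass_apply, lowpass_apply, pow_zero, one_smul, smul_comm]

theorem fourier_lowpass (φ₀ : 𝓢(E n, ℂ)) (N : ℕ) (x : E n) :
    𝓕 (lowpass φ₀ N) x
      = (((2 ^ N : ℝ) ^ n : ℝ) : ℂ) * 𝓕 (lowpass φ₀ 0) ((2 ^ N : ℝ) • x) := by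
  rw [lowpass_eq_dilate, fourier_dilate _ (by positivity)]
  simp only [inv_pow, inv_inv]

theorem exists_fourier_lowpass_bound (φ₀ : 𝓢(E n, ℂ)) (m : ℕ) :
    ∃ C : ℝ, 0 ≤ C ∧ ∀ N x,
      ‖𝓕 (lowpass φ₀ N) x‖ ≤ C * ((2 ^ N) ^ n * ((1 + 2 ^ N * ‖x‖) ^ m)⁻¹) := by
  obtain ⟨C, hC, h⟩ := exists_one_add_norm_bound (𝓕 (lowpass φ₀ 0)) m
  refine ⟨C, hC, fun N x => ?_⟩
  rw [fourier_lowpass, norm_mul, Complex.norm_real, Real.norm_of_nonneg (by positivity)]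
  have := h ((2 ^ N : ℝ) • x)
  rw [norm_smul, Real.norm_of_nonneg (by positivity)] at this
  calc _ ≤ (2 ^ N) ^ n * (C * ((1 + 2 ^ N * ‖x‖) ^ m)⁻¹) := by gcongr
    _ = _ := by ring

theorem lowpass_mul_symbol {φ₀ : 𝓢(E n, ℂ)} (hφ₀ : IsGenerator φ₀) (j : ℕ) :
    schwartzMul (lowpass φ₀ (j + 1)) (symbol φ₀ j) = symbol φ₀ j := by
  ext x
  rw [schwartzMul_apply, lowpass_apply]
  set ξ := (2 * Real.pi) • x with hξ
  have hnorm : ∀ k : ℕ, ‖(2 : ℝ)⁻¹ ^ k • ξ‖ = (2 : ℝ)⁻¹ ^ k * ‖ξ‖ := fun k => by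
    rw [norm_smul, Real.norm_of_nonneg (by positivity)]
  rcases le_or_gt ((2 : ℝ)⁻¹ ^ (j + 1) * ‖ξ‖) 1 with h | h
  · rw [hφ₀.eq_one _ (by rw [hnorm]; exact h), one_mul]
  · have h2 : (2 : ℝ)⁻¹ ^ j * ‖ξ‖ = 2 * ((2 : ℝ)⁻¹ ^ (j + 1) * ‖ξ‖) := by rw [pow_succ]; ring
    have h0 : φ₀ ((2 : ℝ)⁻¹ ^ j • ξ) = 0 := hφ₀.eq_zero _ (by rw [hnorm]; linarith)
    have hs : symbol φ₀ j x = 0 := by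
      cases j with
      | zero => simpa [symbol_zero_apply] using h0
      | succ k =>
        have h3 : (2 : ℝ)⁻¹ ^ k * ‖ξ‖ = 2 * ((2 : ℝ)⁻¹ ^ (k + 1) * ‖ξ‖) := by rw [pow_succ]; ring
        rw [symbol_succ_apply, ← hξ, h0, hφ₀.eq_zero _ (by rw [hnorm]; linarith), sub_zero]
    rw [hs, mul_zero]

/-! ### The dyadic blocks of a tempered distribution -/

theorem continuous_block (φ₀ : 𝓢(E n, ℂ)) (f : 𝓢'(E n, ℂ)) (j : ℕ) : Continuous (block φ₀ f j) :=
  continuous_translate_apply f _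

theorem exists_block_growth (φ₀ : 𝓢(E n, ℂ)) (f : 𝓢'(E n, ℂ)) :
    ∃ N : ℕ, ∀ j, ∃ C : ℝ, 0 ≤ C ∧ ∀ x, ‖block φ₀ f j x‖ ≤ C * (1 + ‖x‖) ^ N := by
  obtain ⟨N, h⟩ := exists_translate_growth f
  exact ⟨N, fun j => h _⟩

theorem integral_mul_block (φ₀ : 𝓢(E n, ℂ)) (f : 𝓢'(E n, ℂ)) (ψ : 𝓢(E n, ℂ)) (j : ℕ) :
    ∫ x, ψ x * block φ₀ f j x = f (𝓕 (schwartzMul (𝓕⁻ ψ) (symbol φ₀ j))) := by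
  refine (apply_convolution f (ψ := ψ) (κ := 𝓕 (symbol φ₀ j)) fun y => ?_).symm
  rw [fourier_mul_eq_convolution, FourierTransform.fourier_fourierInv_eq]

/-- A band-limited function is reproduced by convolution with a rapidly decaying kernel. -/
theorem block_eq_integral {φ₀ : 𝓢(E n, ℂ)} (hφ₀ : IsGenerator φ₀) (f : 𝓢'(E n, ℂ)) (j : ℕ)
    (x : E n) :
    block φ₀ f j x = ∫ y, 𝓕 (lowpass φ₀ (j + 1)) (y - x) * block φ₀ f j y := by
  refine apply_convolution f (ψ := compSubConstCLM ℂ x (𝓕 (lowpass φ₀ (j + 1))))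
    (κ := 𝓕 (symbol φ₀ j)) fun y => ?_
  rw [compSubConstCLM_apply]
  conv_lhs => rw [← lowpass_mul_symbol hφ₀ j]
  rw [fourier_mul_eq_convolution, ← integral_sub_right_eq_self _ x]
  congr 1
  ext1 z
  rw [compSubConstCLM_apply, sub_sub_sub_cancel_right]

theorem integral_fourier_lowpass {φ₀ : 𝓢(E n, ℂ)} (hφ₀ : IsGenerator φ₀) :
    ∫ x, 𝓕 (lowpass φ₀ 0) x = 1 := by
  have h : 𝓕⁻ (𝓕 (lowpass φ₀ 0)) 0 = 1 := by
    rw [FourierTransform.fourierInv_fourier_eq, lowpass_apply]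
    exact hφ₀.eq_one _ (by simp)
  rw [SchwartzMap.fourierInv_coe, Real.fourierInv_eq'] at h
  simpa using h

/-- The partial sums of the dyadic blocks converge to the distribution. -/
theorem tendsto_sum_integral_block {φ₀ : 𝓢(E n, ℂ)} (hφ₀ : IsGenerator φ₀) (f : 𝓢'(E n, ℂ))
    (ψ : 𝓢(E n, ℂ)) :
    Filter.Tendsto (fun N => ∑ j ∈ Finset.range (N + 1), ∫ x, ψ x * block φ₀ f j x)
      Filter.atTop (nhds (f ψ)) := by
  have h1 : ∀ N, ∑ j ∈ Finset.range (N + 1), ∫ x, ψ x * block φ₀ f j x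
      = ∫ x, 𝓕 (lowpass φ₀ 0) x * f (compSubConstCLM ℂ (((2 : ℝ) ^ N)⁻¹ • x) ψ) := by
    intro N
    have h2 : f (𝓕 (schwartzMul (lowpass φ₀ N) (𝓕⁻ ψ)))
        = ∫ x, 𝓕 (lowpass φ₀ N) x * f (compSubConstCLM ℂ x ψ) := by
      refine apply_convolution f fun y => ?_
      rw [fourier_mul_eq_convolution, FourierTransform.fourier_fourierInv_eq]
    have h3 : 𝓕 (schwartzMul (lowpass φ₀ N) (𝓕⁻ ψ))
        = ∑ j ∈ Finset.range (N + 1), 𝓕 (schwartzMul (𝓕⁻ ψ) (symbol φ₀ j)) := by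
      have : schwartzMul (lowpass φ₀ N) (𝓕⁻ ψ)
          = ∑ j ∈ Finset.range (N + 1), schwartzMul (𝓕⁻ ψ) (symbol φ₀ j) := by
        rw [← sum_symbol]
        ext x
        simp only [schwartzMul_apply, sum_apply, Finset.sum_mul]
        exact Finset.sum_congr rfl fun j _ => mul_comm _ _
      rw [this]
      exact map_sum (fourierCLM ℂ 𝓢(E n, ℂ)) _ _
    simp_rw [integral_mul_block]
    rw [← map_sum, ← h3, h2]
    have h4 := Measure.integral_comp_smul_of_nonneg (volume : Measure (E n))
      (fun x => 𝓕 (lowpass φ₀ 0) x * f (compSubConstCLM ℂ (((2 : ℝ) ^ N)⁻¹ • x) ψ)) ((2 : ℝ) ^ N)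
      (hR := by positivity)
    rw [finrank_euclideanSpace_fin, eq_comm, inv_smul_eq_iff₀ (by positivity)] at h4
    rw [h4, Complex.real_smul, ← integral_const_mul]
    congr 1
    ext1 x
    rw [fourier_lowpass, smul_smul, inv_mul_cancel₀ (by positivity), one_smul, mul_assoc]
  simp_rw [h1]
  obtain ⟨m, hm⟩ := exists_translate_growth f
  obtain ⟨C, hC, h⟩ := hm ψ
  have hcont := continuous_translate_apply f ψ
  have hlim : ∫ x, 𝓕 (lowpass φ₀ 0) x * f ψ = f ψ := by
    rw [integral_mul_const, integral_fourier_lowpass hφ₀, one_mul]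
  rw [← hlim]
  refine tendsto_integral_of_dominated_convergence
    (fun x => C * ((1 + ‖x‖) ^ m * ‖𝓕 (lowpass φ₀ 0) x‖))
    (fun N => ?_) ((integrable_one_add_norm_pow_mul _ m).const_mul C) (fun N => ?_) ?_
  · exact (((𝓕 (lowpass φ₀ 0)).continuous).mul
      (hcont.comp (by fun_prop))).aestronglyMeasurable
  · refine Filter.Eventually.of_forall fun x => ?_
    rw [norm_mul]
    have h5 : ‖((2 : ℝ) ^ N)⁻¹ • x‖ ≤ ‖x‖ := by
      rw [norm_smul, Real.norm_of_nonneg (by positivity)]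
      exact mul_le_of_le_one_left (norm_nonneg _) (inv_le_one_of_one_le₀ (one_le_pow₀ one_le_two))
    calc _ ≤ ‖𝓕 (lowpass φ₀ 0) x‖ * (C * (1 + ‖x‖) ^ m) := by
          gcongr
          refine (h _).trans ?_
          gcongr
      _ = _ := by ring
  · refine Filter.Eventually.of_forall fun x => ?_
    refine Filter.Tendsto.const_mul _ ?_
    have h6 : Filter.Tendsto (fun N : ℕ => ((2 : ℝ) ^ N)⁻¹ • x) Filter.atTop (nhds 0) := by
      have : Filter.Tendsto (fun N : ℕ => ((2 : ℝ)⁻¹ ^ N)) Filter.atTop (nhds 0) :=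
        tendsto_pow_atTop_nhds_zero_of_lt_one (by norm_num) (by norm_num)
      simpa [inv_pow] using this.smul_const x
    have h7 := (hcont.tendsto 0).comp h6
    simpa [Function.comp_def] using h7

/-! ### Cubes and polynomially decaying weights -/

/-- The open cube with corner `a` and side length `r`. -/
def cube (a : E n) (r : ℝ) : Set (E n) := {x | ∀ i, a i < x i ∧ x i < a i + r}

theorem dyadicCube_eq_cube (J : ℤ) (M : Fin n → ℤ) :
    dyadicCube J M = cube (WithLp.toLp 2 fun i => (2 : ℝ) ^ (-J) * M i) ((2 : ℝ) ^ (-J)) := by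
  ext x
  simp only [dyadicCube, cube, Set.mem_ofPred_eq, mul_add, mul_one]

theorem cube_eq_preimage (a : E n) (r : ℝ) :
    cube a r = WithLp.ofLp ⁻¹' (Set.univ.pi fun i => Set.Ioo (a i) (a i + r)) := by
  ext x
  simp [cube]

theorem measurableSet_cube (a : E n) (r : ℝ) : MeasurableSet (cube a r) := by
  rw [cube_eq_preimage]
  exact (PiLp.volume_preserving_ofLp (Fin n)).measurable
    (MeasurableSet.univ_pi fun i => measurableSet_Ioo)

theorem measurableSet_dyadicCube (J : ℤ) (M : Fin n → ℤ) : MeasurableSet (dyadicCube J M) := by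
  rw [dyadicCube_eq_cube]; exact measurableSet_cube _ _

theorem volume_cube (a : E n) (r : ℝ) : volume (cube a r) = ENNReal.ofReal r ^ n := by
  rw [cube_eq_preimage, (PiLp.volume_preserving_ofLp (Fin n)).measure_preimage
    (MeasurableSet.univ_pi fun i => measurableSet_Ioo).nullMeasurableSet, Real.volume_pi_Ioo]
  simp

theorem norm_sub_le_of_mem_cube {a : E n} {r : ℝ} {y z : E n} (hy : y ∈ cube a r)
    (hz : z ∈ cube a r) : ‖y - z‖ ≤ n * r := by
  have h : ∀ i, ‖(y - z) i‖ ≤ r := fun i => by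
    have h1 := hy i
    have h2 := hz i
    rw [PiLp.sub_apply, Real.norm_eq_abs, abs_le]
    constructor <;> linarith
  rcases Nat.eq_zero_or_pos n with rfl | hn
  · simp [Subsingleton.elim y z]
  have hr : 0 ≤ r := (norm_nonneg _).trans (h ⟨0, hn⟩)
  rw [EuclideanSpace.norm_eq]
  refine Real.sqrt_le_iff.2 ⟨by positivity, ?_⟩
  calc ∑ i, ‖(y - z) i‖ ^ 2 ≤ ∑ _i : Fin n, r ^ 2 := by gcongr; exact h _
    _ = n * r ^ 2 := by simp
    _ ≤ (n * n : ℝ) * r ^ 2 := by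
      gcongr
      have : (1 : ℝ) ≤ n := by exact_mod_cast hn
      nlinarith
    _ = _ := by ring

theorem dyadicCube_disjoint (J : ℤ) :
    Pairwise (Function.onFun Disjoint (dyadicCube (n := n) J)) := by
  intro M M' hM
  refine Set.disjoint_left.2 fun x hx hx' => hM ?_
  ext i
  have hpos : (0 : ℝ) < 2 ^ (-J) := by positivity
  have h1 : (M i : ℝ) < M' i + 1 := lt_of_mul_lt_mul_left ((hx i).1.trans (hx' i).2) hpos.le
  have h2 : (M' i : ℝ) < M i + 1 := lt_of_mul_lt_mul_left ((hx' i).1.trans (hx i).2) hpos.le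
  have h3 : M i < M' i + 1 := by exact_mod_cast h1
  have h4 : M' i < M i + 1 := by exact_mod_cast h2
  omega

theorem ae_mem_iUnion_dyadicCube (J : ℤ) :
    ∀ᵐ x : E n, x ∈ ⋃ M : Fin n → ℤ, dyadicCube J M := by
  have hpos : (0 : ℝ) < 2 ^ (-J) := by positivity
  have h : ∀ᵐ x : E n, ∀ (i : Fin n) (k : ℤ), x i ≠ 2 ^ (-J) * k := by
    rw [ae_all_iff]
    intro i
    rw [ae_all_iff]
    intro k
    have h0 : ∀ᵐ y : Fin n → ℝ, y i ≠ 2 ^ (-J) * k := by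
      rw [ae_iff]
      simp only [ne_eq, not_not]
      exact Measure.pi_hyperplane (fun _ : Fin n => (volume : Measure ℝ)) i (2 ^ (-J) * k : ℝ)
    exact (PiLp.volume_preserving_ofLp (Fin n)).quasiMeasurePreserving.ae h0
  filter_upwards [h] with x hx
  refine Set.mem_iUnion.2 ⟨fun i => ⌊x i / 2 ^ (-J)⌋, fun i => ⟨?_, ?_⟩⟩
  · refine lt_of_le_of_ne ?_ (hx i _).symm
    have := Int.floor_le (x i / 2 ^ (-J))
    rwa [le_div_iff₀ hpos, mul_comm] at this
  · have := Int.lt_floor_add_one (x i / 2 ^ (-J))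
    rwa [div_lt_iff₀ hpos, mul_comm] at this

theorem lintegral_eq_tsum_dyadicCube (J : ℤ) (F : E n → ℝ≥0∞) :
    ∫⁻ x, F x = ∑' M : Fin n → ℤ, ∫⁻ x in dyadicCube J M, F x := by
  have h : (⋃ M : Fin n → ℤ, dyadicCube J M) =ᵐ[volume] (Set.univ : Set (E n)) :=
    Filter.eventuallyEq_univ.2 (ae_mem_iUnion_dyadicCube J)
  rw [← lintegral_iUnion (measurableSet_dyadicCube J) (dyadicCube_disjoint J),
    Measure.restrict_congr_set h, Measure.restrict_univ]

/-- The weight `(1 + t)^{-m}`. -/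
noncomputable def decay (m : ℕ) (t : ℝ) : ℝ≥0∞ := ENNReal.ofReal (((1 + t) ^ m)⁻¹)

theorem measurable_decay (m : ℕ) : Measurable (decay m) := by
  unfold decay
  fun_prop

theorem measurable_decay_comp (m : ℕ) {c : ℝ} (x : E n) :
    Measurable fun z : E n => decay m (c * ‖z - x‖) :=
  (measurable_decay m).comp (by fun_prop)

/-- The integral of the weight `(1 + ‖x‖)^{-m}`. -/
noncomputable def decayMass (n m : ℕ) : ℝ≥0∞ := ∫⁻ z : E n, decay m ‖z‖

theorem decayMass_lt_top {m : ℕ} (hm : n < m) : decayMass n m < ∞ := by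
  have h := finite_integral_one_add_norm (E := E n) (μ := volume) (r := m)
    (by rw [finrank_euclideanSpace_fin]; exact_mod_cast hm)
  refine lt_of_le_of_lt (le_of_eq ?_) h
  refine lintegral_congr fun z => ?_
  rw [decay, Real.rpow_neg (by positivity), Real.rpow_natCast]

theorem lintegral_comp_smul_eq (F : E n → ℝ≥0∞) {c : ℝ} (hc : 0 < c) :
    ∫⁻ x, F (c • x) = ENNReal.ofReal (c⁻¹ ^ n) * ∫⁻ x, F x := by
  have h := Measure.map_addHaar_smul (volume : Measure (E n)) hc.ne'
  have h1 : ∫⁻ x, F x ∂(Measure.map (c • ·) volume) = ∫⁻ x, F (c • x) :=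
    (Homeomorph.smulOfNeZero c hc.ne').measurableEmbedding.lintegral_map F
  rw [← h1, h, lintegral_smul_measure, finrank_euclideanSpace_fin, inv_pow,
    abs_of_pos (by positivity), smul_eq_mul]

theorem lintegral_decay (m : ℕ) (x : E n) {c : ℝ} (hc : 0 < c) :
    ∫⁻ y, decay m (c * ‖y - x‖) = ENNReal.ofReal (c⁻¹ ^ n) * decayMass n m := by
  rw [lintegral_sub_right_eq_self (fun y => decay m (c * ‖y‖)) x]
  have h := lintegral_comp_smul_eq (fun y : E n => decay m ‖y‖) hc
  simp_rw [norm_smul, Real.norm_of_nonneg hc.le] at h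
  exact h

/-- The weight at scale `r` is essentially constant on cubes of side length `r`. -/
theorem decay_le_of_mem_cube (m : ℕ) {a : E n} {r : ℝ} (hr : 0 < r) {y z : E n}
    (hy : y ∈ cube a r) (hz : z ∈ cube a r) (x : E n) :
    decay m (r⁻¹ * ‖y - x‖) ≤ ENNReal.ofReal ((1 + n) ^ m) * decay m (r⁻¹ * ‖z - x‖) := by
  rw [decay, decay, ← ENNReal.ofReal_mul (by positivity)]
  refine ENNReal.ofReal_le_ofReal ?_
  have h1 : 1 + r⁻¹ * ‖z - x‖ ≤ (1 + n) * (1 + r⁻¹ * ‖y - x‖) := by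
    have h2 : ‖z - x‖ ≤ ‖y - z‖ + ‖y - x‖ := by
      rw [norm_sub_rev y z]
      exact norm_sub_le_norm_sub_add_norm_sub _ _ _
    have h3 := norm_sub_le_of_mem_cube hy hz
    have h4 : r⁻¹ * ‖z - x‖ ≤ n + r⁻¹ * ‖y - x‖ := by
      calc r⁻¹ * ‖z - x‖ ≤ r⁻¹ * (n * r + ‖y - x‖) := by gcongr; linarith
        _ = _ := by field_simp
    have h5 : 0 ≤ (n : ℝ) * (r⁻¹ * ‖y - x‖) := by positivity
    linarith
  rw [← div_eq_mul_inv, le_div_iff₀ (by positivity), inv_mul_le_iff₀ (by positivity), ← mul_pow,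
    mul_comm (1 + r⁻¹ * ‖y - x‖)]
  gcongr

/-- The weight at scale `r` is dominated by its averages over cubes of side length `r`. -/
theorem decay_le_average (m : ℕ) {a : E n} {r : ℝ} (hr : 0 < r) {y : E n}
    (hy : y ∈ cube a r) (x : E n) :
    decay m (r⁻¹ * ‖y - x‖) ≤ ENNReal.ofReal ((1 + n) ^ m * r⁻¹ ^ n) *
      ∫⁻ z in cube a r, decay m (r⁻¹ * ‖z - x‖) := by
  have h : decay m (r⁻¹ * ‖y - x‖) * volume (cube a r) ≤
      ENNReal.ofReal ((1 + n) ^ m) * ∫⁻ z in cube a r, decay m (r⁻¹ * ‖z - x‖) := by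
    rw [← setLIntegral_const, ← lintegral_const_mul _ (measurable_decay_comp m x)]
    exact setLIntegral_mono' (measurableSet_cube a r) fun z hz => decay_le_of_mem_cube m hr hy hz x
  have h1 : ENNReal.ofReal (r⁻¹ ^ n) * volume (cube a r) = 1 := by
    rw [volume_cube, ← ENNReal.ofReal_pow hr.le, ← ENNReal.ofReal_mul (by positivity), ← mul_pow,
      inv_mul_cancel₀ hr.ne', one_pow, ENNReal.ofReal_one]
  calc decay m (r⁻¹ * ‖y - x‖)
      = ENNReal.ofReal (r⁻¹ ^ n) * (decay m (r⁻¹ * ‖y - x‖) * volume (cube a r)) := by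
        rw [mul_left_comm, h1, mul_one]
    _ ≤ ENNReal.ofReal (r⁻¹ ^ n) *
        (ENNReal.ofReal ((1 + n) ^ m) * ∫⁻ z in cube a r, decay m (r⁻¹ * ‖z - x‖)) := by gcongr
    _ = _ := by
      rw [← mul_assoc, ← ENNReal.ofReal_mul (by positivity), mul_comm (r⁻¹ ^ n)]

/-- A uniform bound for the integrals of `F` over the dyadic cubes of one generation bounds the
convolution of `F` with a weight of the same scale. -/
theorem lintegral_mul_decay_le (m : ℕ) (J : ℤ) {F : E n → ℝ≥0∞} (hF : Measurable F) {A : ℝ≥0∞}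
    (hA : ∀ M : Fin n → ℤ, ∫⁻ y in dyadicCube J M, F y ≤ A) (x : E n) :
    ∫⁻ y, F y * decay m (2 ^ J * ‖y - x‖) ≤
      ENNReal.ofReal ((1 + n) ^ m) * decayMass n m * A := by
  set r : ℝ := 2 ^ (-J) with hr_def
  have hr : 0 < r := by positivity
  have hrJ : (2 : ℝ) ^ J = r⁻¹ := by rw [hr_def, zpow_neg, inv_inv]
  rw [hrJ, lintegral_eq_tsum_dyadicCube J]
  have h : ∀ M : Fin n → ℤ, ∫⁻ y in dyadicCube J M, F y * decay m (r⁻¹ * ‖y - x‖) ≤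
      ENNReal.ofReal ((1 + n) ^ m * r⁻¹ ^ n) * A *
        ∫⁻ z in dyadicCube J M, decay m (r⁻¹ * ‖z - x‖) := by
    intro M
    set B := ENNReal.ofReal ((1 + n) ^ m * r⁻¹ ^ n) *
        ∫⁻ z in dyadicCube J M, decay m (r⁻¹ * ‖z - x‖) with hB
    calc ∫⁻ y in dyadicCube J M, F y * decay m (r⁻¹ * ‖y - x‖)
        ≤ ∫⁻ y in dyadicCube J M, F y * B := by
          refine setLIntegral_mono' (measurableSet_dyadicCube J M) fun y hy => ?_
          gcongr
          rw [hB, dyadicCube_eq_cube] at *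
          exact decay_le_average m hr hy x
      _ = (∫⁻ y in dyadicCube J M, F y) * B := lintegral_mul_const _ hF
      _ ≤ A * B := by gcongr; exact hA M
      _ = _ := by rw [hB]; ring
  calc _ ≤ ∑' M : Fin n → ℤ, ENNReal.ofReal ((1 + n) ^ m * r⁻¹ ^ n) * A *
        ∫⁻ z in dyadicCube J M, decay m (r⁻¹ * ‖z - x‖) := ENNReal.tsum_le_tsum h
    _ = ENNReal.ofReal ((1 + n) ^ m * r⁻¹ ^ n) * A * ∫⁻ z, decay m (r⁻¹ * ‖z - x‖) := by
      rw [ENNReal.tsum_mul_left, ← lintegral_eq_tsum_dyadicCube]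
    _ = (ENNReal.ofReal ((1 + n) ^ m * r⁻¹ ^ n) * ENNReal.ofReal (r⁻¹⁻¹ ^ n)) *
        decayMass n m * A := by
      rw [lintegral_decay m x (inv_pos.2 hr)]; ring
    _ = _ := by
      rw [← ENNReal.ofReal_mul (by positivity), mul_assoc ((1 + n : ℝ) ^ m), ← mul_pow,
        mul_inv_cancel₀ (inv_pos.2 hr).ne', one_pow, mul_one]

/-! ### Distributions with summable blocks are locally integrable -/

theorem enorm_le_mul_decay {F : Type*} [NormedAddCommGroup F] {v : F} {C t : ℝ} {m : ℕ} (hC : 0 ≤ C)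
    (h : ‖v‖ ≤ C * ((1 + t) ^ m)⁻¹) : ‖v‖ₑ ≤ ENNReal.ofReal C * decay m t := by
  rw [decay, ← ENNReal.ofReal_mul hC, ← ofReal_norm]
  exact ENNReal.ofReal_le_ofReal h

theorem decay_ne_zero (m : ℕ) {t : ℝ} (ht : 0 ≤ t) : decay m t ≠ 0 := by
  rw [decay, ne_eq, ENNReal.ofReal_eq_zero, not_le]
  positivity

theorem decay_mul_ofReal (m : ℕ) {t : ℝ} (ht : 0 ≤ t) :
    decay m t * ENNReal.ofReal ((1 + t) ^ m) = 1 := by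
  rw [decay, ← ENNReal.ofReal_mul (by positivity), inv_mul_cancel₀ (by positivity),
    ENNReal.ofReal_one]

/-- If the blocks of `f` are summable in a weighted `L_1` space, then `f` is represented by their
sum. -/
theorem mem_L1loc_of_tsum_ne_top {φ₀ : 𝓢(E n, ℂ)} (hφ₀ : IsGenerator φ₀) (f : 𝓢'(E n, ℂ)) {m : ℕ}
    (h : ∑' j, ∫⁻ y, ‖block φ₀ f j y‖ₑ * decay m ‖y‖ ≠ ∞) : f ∈ L1loc n := by
  set u := block φ₀ f with hu
  have hcont : ∀ j, Continuous (u j) := continuous_block φ₀ f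
  have hmeasd : Measurable fun y : E n => decay m ‖y‖ := (measurable_decay m).comp measurable_norm
  have hmeas : ∀ j, Measurable fun y => ‖u j y‖ₑ * decay m ‖y‖ := fun j =>
    (hcont j).enorm.measurable.mul hmeasd
  have hae : ∀ᵐ y, Summable fun j => u j y := by
    have h1 : ∫⁻ y, ∑' j, ‖u j y‖ₑ * decay m ‖y‖ ≠ ∞ := by
      rwa [lintegral_tsum fun j => (hmeas j).aemeasurable]
    filter_upwards [ae_lt_top (Measurable.tsum hmeas) h1] with y hy
    rw [ENNReal.tsum_mul_right] at hy
    have h2 : ∑' j, ‖u j y‖ₑ ≠ ∞ := fun h3 => by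
      rw [h3, ENNReal.top_mul (decay_ne_zero m (norm_nonneg y))] at hy
      exact hy.ne rfl
    exact (tsum_enorm_ne_top_iff_summable_norm.1 h2).of_norm
  have hgmeas : AEStronglyMeasurable (fun y => ∑' j, u j y) (volume : Measure (E n)) :=
    (Measurable.tsum fun j => (hcont j).measurable).aestronglyMeasurable
  refine ⟨fun y => ∑' j, u j y, ?_, fun ψ _ => ?_⟩
  · rw [locallyIntegrable_iff]
    intro K hK
    refine ⟨hgmeas.restrict, ?_⟩
    obtain ⟨R, hR⟩ := hK.isBounded.subset_closedBall (0 : E n)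
    rw [hasFiniteIntegral_iff_enorm]
    calc ∫⁻ y in K, ‖∑' j, u j y‖ₑ
        ≤ ∫⁻ y in K, ENNReal.ofReal ((1 + R) ^ m) * ∑' j, ‖u j y‖ₑ * decay m ‖y‖ := by
          refine setLIntegral_mono' hK.measurableSet fun y hy => ?_
          have hyR : ‖y‖ ≤ R := mem_closedBall_zero_iff.1 (hR hy)
          refine enorm_tsum_le_tsum_enorm.trans ?_
          rw [ENNReal.tsum_mul_right, mul_left_comm]
          refine le_mul_of_one_le_right' ?_
          rw [← decay_mul_ofReal m (norm_nonneg y), mul_comm]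
          gcongr
      _ ≤ ∫⁻ y, ENNReal.ofReal ((1 + R) ^ m) * ∑' j, ‖u j y‖ₑ * decay m ‖y‖ :=
          setLIntegral_le_lintegral _ _
      _ = ENNReal.ofReal ((1 + R) ^ m) * ∑' j, ∫⁻ y, ‖u j y‖ₑ * decay m ‖y‖ := by
          rw [lintegral_const_mul _ (Measurable.tsum hmeas),
            lintegral_tsum fun j => (hmeas j).aemeasurable]
      _ < ∞ := ENNReal.mul_lt_top ENNReal.ofReal_lt_top h.lt_top
  · obtain ⟨C, hC, hψ⟩ := exists_one_add_norm_bound ψ m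
    have hbd : ∀ j, ∫⁻ y, ‖ψ y * u j y‖ₑ ≤
        ENNReal.ofReal C * ∫⁻ y, ‖u j y‖ₑ * decay m ‖y‖ := fun j => by
      rw [← lintegral_const_mul _ (hmeas j)]
      refine lintegral_mono fun y => ?_
      rw [enorm_mul, mul_comm, mul_left_comm]
      gcongr
      exact enorm_le_mul_decay hC (hψ y)
    have hsum : ∑' j, ∫⁻ y, ‖ψ y * u j y‖ₑ ≠ ∞ := by
      refine ne_top_of_le_ne_top ?_ (ENNReal.tsum_le_tsum hbd)
      rw [ENNReal.tsum_mul_left]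
      exact ENNReal.mul_ne_top ENNReal.ofReal_ne_top h
    have hm2 : ∀ j, AEStronglyMeasurable (fun y => ψ y * u j y) (volume : Measure (E n)) := fun j =>
      (ψ.continuous.mul (hcont j)).aestronglyMeasurable
    have hint : ∀ j, Integrable fun y => ψ y * u j y := fun j =>
      ⟨hm2 j, by
        rw [hasFiniteIntegral_iff_enorm]
        exact (ENNReal.ne_top_of_tsum_ne_top hsum j).lt_top⟩
    have hsumm : Summable fun j => ∫ y, ‖ψ y * u j y‖ := by
      have := ENNReal.summable_toReal hsum
      refine this.congr fun j => ?_
      rw [integral_norm_eq_lintegral_enorm (hm2 j)]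
    have hS := (hasSum_integral_of_summable_integral_norm hint hsumm).tendsto_sum_nat
    have h1 := tendsto_nhds_unique (hS.comp (Filter.tendsto_add_atTop_nat 1))
      (tendsto_sum_integral_block hφ₀ f ψ)
    rw [← h1]
    refine integral_congr_ae ?_
    filter_upwards [hae] with y hy
    rw [tsum_mul_left, mul_comm]

/-! ### A maximal inequality for band-limited functions -/

/-- The inequality of Plancherel–Polya type for `p ≤ 1`: a continuous function of polynomial growth
that is reproduced by a kernel which decays rapidly at scale `2^{-J}` is bounded by its `L_p`
quasi-norms over the dyadic cubes of side length `2^{-J}`. -/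
theorem enorm_rpow_le_of_reproducing {G : E n → ℂ} (hG : Continuous G) {N : ℕ} {C₀ : ℝ}
    (hC₀ : 0 ≤ C₀) (hgrowth : ∀ x, ‖G x‖ ≤ C₀ * (1 + ‖x‖) ^ N) {κ : E n → ℂ} {J : ℤ} (hJ : 0 ≤ J)
    (hrep : ∀ x, G x = ∫ y, κ (y - x) * G y) {B : ℝ} (hB : 0 ≤ B)
    (hκ : ∀ z, ‖κ z‖ ≤ B * ((1 + 2 ^ J * ‖z‖) ^ (N + (n + 1)))⁻¹) {p : ℝ} (hp : 0 < p) (hp1 : p ≤ 1)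
    {A : ℝ≥0∞} (hA : ∀ M : Fin n → ℤ, ∫⁻ y in dyadicCube J M, ‖G y‖ₑ ^ p ≤ A) (x : E n) :
    ‖G x‖ₑ ^ p ≤
      ENNReal.ofReal B * (ENNReal.ofReal ((1 + n) ^ (n + 1)) * decayMass n (n + 1) * A) := by
  set D := ENNReal.ofReal B * (ENNReal.ofReal ((1 + n) ^ (n + 1)) * decayMass n (n + 1) * A)
  have h2J : (1 : ℝ) ≤ 2 ^ J := one_le_zpow₀ one_le_two hJ
  -- The weight with a small parameter makes the supremum finite, so that it can be absorbed.
  have key : ∀ ε : ℝ, 0 < ε → ε ≤ 1 → ∀ x, (‖G x‖ₑ * decay N (ε * ‖x‖)) ^ p ≤ D := by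
    intro ε hε hε1
    set S := ⨆ x, ‖G x‖ₑ * decay N (ε * ‖x‖) with hS
    have hSx : ∀ x, ‖G x‖ₑ * decay N (ε * ‖x‖) ≤ S := fun x => le_iSup_of_le x le_rfl
    have hStop : S ≠ ∞ := by
      refine ne_top_of_le_ne_top (b := ENNReal.ofReal (C₀ * ε⁻¹ ^ N)) ENNReal.ofReal_ne_top ?_
      refine iSup_le fun x => ?_
      rw [decay, ← ofReal_norm, ← ENNReal.ofReal_mul (norm_nonneg _)]
      refine ENNReal.ofReal_le_ofReal ?_
      have h1 : 1 + ‖x‖ ≤ ε⁻¹ * (1 + ε * ‖x‖) := by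
        rw [mul_add, inv_mul_cancel_left₀ hε.ne', mul_one]
        linarith [(one_le_inv₀ hε).2 hε1]
      rw [← div_eq_mul_inv, div_le_iff₀ (by positivity), mul_assoc, ← mul_pow]
      refine (hgrowth x).trans ?_
      gcongr
    have hGS : ∀ y, ‖G y‖ₑ ≤ S * ENNReal.ofReal ((1 + ε * ‖y‖) ^ N) := fun y => by
      calc ‖G y‖ₑ = ‖G y‖ₑ * decay N (ε * ‖y‖) * ENNReal.ofReal ((1 + ε * ‖y‖) ^ N) := by
            rw [mul_assoc, decay_mul_ofReal N (by positivity), mul_one]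
        _ ≤ _ := by gcongr; exact hSx y
    have hGp : ∀ y, ‖G y‖ₑ ≤
        S ^ (1 - p) * ENNReal.ofReal ((1 + ε * ‖y‖) ^ N) * ‖G y‖ₑ ^ p := fun y => by
      have h1 : (1 : ℝ≥0∞) ≤ ENNReal.ofReal ((1 + ε * ‖y‖) ^ N) := by
        rw [ENNReal.one_le_ofReal]
        exact one_le_pow₀ (by linarith [mul_nonneg hε.le (norm_nonneg y)])
      calc ‖G y‖ₑ = ‖G y‖ₑ ^ (1 - p) * ‖G y‖ₑ ^ p := by
            rw [← ENNReal.rpow_add_of_nonneg _ _ (by linarith) hp.le, sub_add_cancel,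
              ENNReal.rpow_one]
        _ ≤ (S * ENNReal.ofReal ((1 + ε * ‖y‖) ^ N)) ^ (1 - p) * ‖G y‖ₑ ^ p := by
            gcongr
            exact hGS y
        _ = S ^ (1 - p) * ENNReal.ofReal ((1 + ε * ‖y‖) ^ N) ^ (1 - p) * ‖G y‖ₑ ^ p := by
            rw [ENNReal.mul_rpow_of_nonneg _ _ (by linarith)]
        _ ≤ S ^ (1 - p) * ENNReal.ofReal ((1 + ε * ‖y‖) ^ N) ^ (1 : ℝ) * ‖G y‖ₑ ^ p := by
            gcongr
            linarith
        _ = _ := by rw [ENNReal.rpow_one]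
    have hpt : ∀ x y, ‖κ (y - x)‖ₑ * ‖G y‖ₑ * decay N (ε * ‖x‖) ≤
        S ^ (1 - p) * ENNReal.ofReal B * (‖G y‖ₑ ^ p * decay (n + 1) (2 ^ J * ‖y - x‖)) := by
      intro x y
      have h1 : ‖κ (y - x)‖ₑ * ENNReal.ofReal ((1 + ε * ‖y‖) ^ N) * decay N (ε * ‖x‖) ≤
          ENNReal.ofReal B * decay (n + 1) (2 ^ J * ‖y - x‖) := by
        rw [decay, decay, ← ofReal_norm, ← ENNReal.ofReal_mul (norm_nonneg _),
          ← ENNReal.ofReal_mul (by positivity), ← ENNReal.ofReal_mul hB]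
        refine ENNReal.ofReal_le_ofReal ?_
        have h2 : 1 + ε * ‖y‖ ≤ (1 + 2 ^ J * ‖y - x‖) * (1 + ε * ‖x‖) := by
          have h3 : ‖y‖ ≤ ‖y - x‖ + ‖x‖ := by simpa using norm_add_le (y - x) x
          have h4 : ε * ‖y - x‖ ≤ 2 ^ J * ‖y - x‖ := by gcongr; linarith
          have h5 : 0 ≤ 2 ^ J * ‖y - x‖ * (ε * ‖x‖) := by positivity
          nlinarith
        have h6 : (1 + ε * ‖y‖) ^ N ≤ (1 + 2 ^ J * ‖y - x‖) ^ N * (1 + ε * ‖x‖) ^ N := by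
          rw [← mul_pow]; gcongr
        calc ‖κ (y - x)‖ * (1 + ε * ‖y‖) ^ N * ((1 + ε * ‖x‖) ^ N)⁻¹
            ≤ (B * ((1 + 2 ^ J * ‖y - x‖) ^ (N + (n + 1)))⁻¹) *
              ((1 + 2 ^ J * ‖y - x‖) ^ N * (1 + ε * ‖x‖) ^ N) * ((1 + ε * ‖x‖) ^ N)⁻¹ := by
              gcongr
              exact hκ _
          _ = _ := by
              rw [pow_add]
              field_simp
      calc ‖κ (y - x)‖ₑ * ‖G y‖ₑ * decay N (ε * ‖x‖)
          ≤ ‖κ (y - x)‖ₑ * (S ^ (1 - p) * ENNReal.ofReal ((1 + ε * ‖y‖) ^ N) * ‖G y‖ₑ ^ p) *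
            decay N (ε * ‖x‖) := by gcongr; exact hGp y
        _ = S ^ (1 - p) * ‖G y‖ₑ ^ p *
            (‖κ (y - x)‖ₑ * ENNReal.ofReal ((1 + ε * ‖y‖) ^ N) * decay N (ε * ‖x‖)) := by ring
        _ ≤ S ^ (1 - p) * ‖G y‖ₑ ^ p *
            (ENNReal.ofReal B * decay (n + 1) (2 ^ J * ‖y - x‖)) := by gcongr
        _ = _ := by ring
    have hmG : Measurable fun y => ‖G y‖ₑ ^ p := hG.enorm.measurable.pow_const p
    have hSle : S ≤ S ^ (1 - p) * D := by
      refine iSup_le fun x => ?_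
      calc ‖G x‖ₑ * decay N (ε * ‖x‖)
          ≤ (∫⁻ y, ‖κ (y - x)‖ₑ * ‖G y‖ₑ) * decay N (ε * ‖x‖) := by
            gcongr
            conv_lhs => rw [hrep x]
            refine (enorm_integral_le_lintegral_enorm _).trans_eq ?_
            simp_rw [enorm_mul]
        _ = ∫⁻ y, ‖κ (y - x)‖ₑ * ‖G y‖ₑ * decay N (ε * ‖x‖) := by
            rw [lintegral_mul_const']
            exact ENNReal.ofReal_ne_top
        _ ≤ ∫⁻ y, S ^ (1 - p) * ENNReal.ofReal B *
              (‖G y‖ₑ ^ p * decay (n + 1) (2 ^ J * ‖y - x‖)) := lintegral_mono (hpt x)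
        _ = S ^ (1 - p) * ENNReal.ofReal B *
              ∫⁻ y, ‖G y‖ₑ ^ p * decay (n + 1) (2 ^ J * ‖y - x‖) :=
            lintegral_const_mul _ (hmG.mul (measurable_decay_comp _ x))
        _ ≤ S ^ (1 - p) * ENNReal.ofReal B *
              (ENNReal.ofReal ((1 + n) ^ (n + 1)) * decayMass n (n + 1) * A) := by
            gcongr
            exact lintegral_mul_decay_le (n + 1) J hmG hA x
        _ = _ := by rw [mul_assoc]
    have hSp : S ^ p ≤ D := by
      rcases eq_or_ne S 0 with h0 | h0
      · rw [h0, ENNReal.zero_rpow_of_pos hp]; exact zero_le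
      · have h1 : S ^ (1 - p) * S ^ p ≤ S ^ (1 - p) * D := by
          rwa [← ENNReal.rpow_add _ _ h0 hStop, sub_add_cancel, ENNReal.rpow_one]
        exact (ENNReal.mul_le_mul_iff_right (by simp [ENNReal.rpow_eq_zero_iff, h0, hStop])
          (ENNReal.rpow_ne_top_of_nonneg (by linarith) hStop)).1 h1
    intro x
    exact (ENNReal.rpow_le_rpow (hSx x) hp.le).trans hSp
  have hlim : Filter.Tendsto (fun ε : ℝ => ‖G x‖ₑ * decay N (ε * ‖x‖))
      (nhdsWithin 0 (Set.Ioi 0)) (nhds ‖G x‖ₑ) := by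
    have h1 : Filter.Tendsto (fun ε : ℝ => decay N (ε * ‖x‖)) (nhds 0) (nhds 1) := by
      have h2 : ContinuousAt (fun ε : ℝ => ((1 + ε * ‖x‖) ^ N)⁻¹) 0 := by
        refine ContinuousAt.inv₀ (by fun_prop) (by simp)
      have h3 := (ENNReal.continuous_ofReal.tendsto _).comp h2.tendsto
      simpa [Function.comp_def, decay] using h3
    have h4 := ENNReal.Tendsto.const_mul (a := ‖G x‖ₑ) h1 (Or.inr enorm_ne_top)
    rw [mul_one] at h4
    exact h4.mono_left nhdsWithin_le_nhds
  refine le_of_tendsto (((ENNReal.continuous_rpow_const (y := p)).tendsto _).comp hlim) ?_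
  filter_upwards [Ioc_mem_nhdsGT (zero_lt_one (α := ℝ))] with ε hε
  exact key ε hε.1 hε.2 x

/-! ### Local estimates shared by the four spaces -/

theorem le_lqNorm {q : ℝ≥0∞} (hq : 0 < q) (a : ℕ → ℝ≥0∞) (j : ℕ) : a j ≤ lqNorm q a := by
  rw [lqNorm]
  split_ifs with h
  · exact le_iSup a j
  · have ht : 0 < q.toReal := ENNReal.toReal_pos hq.ne' h
    calc a j = (a j ^ q.toReal) ^ (1 / q.toReal) := by
          rw [← ENNReal.rpow_mul, mul_one_div_cancel ht.ne', ENNReal.rpow_one]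
      _ ≤ _ := by
          gcongr
          exact ENNReal.le_tsum (f := fun j => a j ^ q.toReal) j

theorem lpNormOn_mono {p : ℝ} (hp : 0 < p) (A : Set (E n)) {g g' : E n → ℝ≥0∞}
    (h : ∀ x, g x ≤ g' x) : lpNormOn p A g ≤ lpNormOn p A g' := by
  unfold lpNormOn
  gcongr with x
  exact h x

theorem exists_local_bound {φ₀ : 𝓢(E n, ℂ)} {s p ϱ : ℝ} {q : ℝ≥0∞} (hp : 0 < p) (hq : 0 < q)
    {X : Set 𝓢'(E n, ℂ)} (hX : X ∈ clan n φ₀ ϱ s p q) {f : 𝓢'(E n, ℂ)} (hf : f ∈ X) :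
    ∃ C : ℝ≥0∞, C ≠ ∞ ∧ ∀ (J : ℤ) (M : Fin n → ℤ) (j : ℕ), max J 0 ≤ (j : ℤ) →
      morreyWeight n ϱ p J * lpNormOn p (dyadicCube J M) (wblock φ₀ s f j) ≤ C := by
  simp only [clan, Set.mem_insert_iff, Set.mem_singleton_iff] at hX
  have htail : ∀ {J : ℤ} {j : ℕ}, max J 0 ≤ (j : ℤ) → ∀ a : ℕ → ℝ≥0∞, a j = tail J a j :=
    fun h a => by rw [tail, if_pos h]
  rcases hX with rfl | rfl | rfl | rfl
  · refine ⟨_, LT.lt.ne hf, fun J M j _ => ?_⟩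
    refine le_trans ?_ (le_lqNorm hq _ j)
    exact le_iSup₂_of_le J M le_rfl
  · refine ⟨_, LT.lt.ne hf, fun J M j hj => ?_⟩
    refine le_iSup₂_of_le J M ?_
    gcongr
    refine le_trans (htail hj fun j => lpNormOn p (dyadicCube J M) (wblock φ₀ s f j)).le ?_
    exact le_lqNorm hq _ j
  · refine ⟨_, LT.lt.ne hf, fun J M j _ => ?_⟩
    refine le_iSup₂_of_le J M ?_
    gcongr
    exact lpNormOn_mono hp _ fun x => le_lqNorm hq (fun j => wblock φ₀ s f j x) j
  · refine ⟨_, LT.lt.ne hf, fun J M j hj => ?_⟩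
    refine le_iSup₂_of_le J M ?_
    gcongr
    refine lpNormOn_mono hp _ fun x => ?_
    refine le_trans (htail hj fun j => wblock φ₀ s f j x).le ?_
    exact le_lqNorm hq _ j

theorem two_rpow_add (x y : ℝ) : (2 : ℝ≥0∞) ^ (x + y) = 2 ^ x * 2 ^ y :=
  ENNReal.rpow_add _ _ two_ne_zero ENNReal.ofNat_ne_top

theorem two_rpow_ne_top (x : ℝ) : (2 : ℝ≥0∞) ^ x ≠ ∞ :=
  ENNReal.rpow_ne_top_of_ne_zero two_ne_zero ENNReal.ofNat_ne_top

theorem two_rpow_mul_rpow_neg (x : ℝ) : (2 : ℝ≥0∞) ^ x * 2 ^ (-x) = 1 := by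
  rw [← two_rpow_add, add_neg_cancel, ENNReal.rpow_zero]

theorem le_mul_two_rpow_neg {a b : ℝ≥0∞} {x : ℝ} (h : 2 ^ x * a ≤ b) : a ≤ b * 2 ^ (-x) :=
  calc a = (2 ^ x * a) * 2 ^ (-x) := by
        rw [mul_right_comm, two_rpow_mul_rpow_neg, one_mul]
    _ ≤ _ := by gcongr

theorem morreyWeight_mul_lpNormOn_rpow {φ₀ : 𝓢(E n, ℂ)} {s p ϱ : ℝ} (hp : 0 < p)
    (f : 𝓢'(E n, ℂ)) (J : ℤ) (A : Set (E n)) (j : ℕ) :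
    (morreyWeight n ϱ p J * lpNormOn p A (wblock φ₀ s f j)) ^ p =
      2 ^ (J * (n + ϱ) + j * s * p) * ∫⁻ x in A, ‖block φ₀ f j x‖ₑ ^ p := by
  have h : ∫⁻ x in A, wblock φ₀ s f j x ^ p
      = 2 ^ (j * s * p) * ∫⁻ x in A, ‖block φ₀ f j x‖ₑ ^ p := by
    rw [← lintegral_const_mul' _ _ (two_rpow_ne_top _)]
    refine lintegral_congr fun x => ?_
    rw [wblock, ENNReal.mul_rpow_of_nonneg _ _ hp.le, ← ENNReal.rpow_mul]
  rw [ENNReal.mul_rpow_of_nonneg _ _ hp.le, lpNormOn, ← ENNReal.rpow_mul, one_div,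
    inv_mul_cancel₀ hp.ne', ENNReal.rpow_one, morreyWeight, ← ENNReal.rpow_mul, h, two_rpow_add,
    ← mul_assoc]
  congr 3
  field_simp

/-- The estimate of the blocks on small cubes, common to all members of the clan. -/
theorem exists_lintegral_block_rpow_le {φ₀ : 𝓢(E n, ℂ)} {s p ϱ : ℝ} {q : ℝ≥0∞} (hp : 0 < p)
    (hq : 0 < q) {X : Set 𝓢'(E n, ℂ)} (hX : X ∈ clan n φ₀ ϱ s p q) {f : 𝓢'(E n, ℂ)} (hf : f ∈ X) :
    ∃ C : ℝ≥0∞, C ≠ ∞ ∧ ∀ (J : ℤ) (M : Fin n → ℤ) (j : ℕ), max J 0 ≤ (j : ℤ) →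
      ∫⁻ x in dyadicCube J M, ‖block φ₀ f j x‖ₑ ^ p ≤ C * 2 ^ (-(J * (n + ϱ) + j * s * p)) := by
  obtain ⟨C, hC, h⟩ := exists_local_bound hp hq hX hf
  refine ⟨C ^ p, ENNReal.rpow_ne_top_of_nonneg hp.le hC, fun J M j hj => ?_⟩
  apply le_mul_two_rpow_neg
  rw [← morreyWeight_mul_lpNormOn_rpow hp]
  exact ENNReal.rpow_le_rpow (h J M j hj) hp.le

theorem volume_dyadicCube_zero (M : Fin n → ℤ) : volume (dyadicCube 0 M) = 1 := by
  rw [dyadicCube_eq_cube, volume_cube]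
  simp

theorem le_add_rpow_mul_rpow {p : ℝ} (hp : 1 ≤ p) (t : ℝ≥0∞) {a : ℝ≥0∞} (ha : a ≠ 0)
    (ha' : a ≠ ∞) : t ≤ a + t ^ p * a ^ (1 - p) := by
  rcases le_or_gt t a with h | h
  · exact h.trans le_self_add
  · refine le_trans ?_ le_add_self
    have h1 : t ≤ t * (t ^ (p - 1) * a ^ (1 - p)) := by
      refine le_mul_of_one_le_right' ?_
      calc (1 : ℝ≥0∞) = a ^ (p - 1) * a ^ (1 - p) := by
            rw [← ENNReal.rpow_add _ _ ha ha', sub_add_sub_cancel, sub_self, ENNReal.rpow_zero]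
        _ ≤ _ := by gcongr
    refine h1.trans_eq ?_
    rw [← mul_assoc]
    congr 1
    have h2 := ENNReal.rpow_add_of_nonneg (x := t) 1 (p - 1) zero_le_one (by linarith)
    rw [ENNReal.rpow_one, add_sub_cancel] at h2
    exact h2.symm

/-- The blocks of a member of one of the spaces decay geometrically in `L_1` over the unit cubes,
with the rate `s - σ`. -/
theorem exists_lintegral_block_le {φ₀ : 𝓢(E n, ℂ)} (hφ₀ : IsGenerator φ₀) {s p ϱ : ℝ} {q : ℝ≥0∞}
    (hp : 0 < p) (hq : 0 < q) (hϱ : ϱ < 0) {X : Set 𝓢'(E n, ℂ)} (hX : X ∈ clan n φ₀ ϱ s p q)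
    {f : 𝓢'(E n, ℂ)} (hf : f ∈ X) :
    ∃ C : ℝ≥0∞, C ≠ ∞ ∧ ∀ (M : Fin n → ℤ) (j : ℕ),
      ∫⁻ x in dyadicCube 0 M, ‖block φ₀ f j x‖ₑ ≤ C * 2 ^ (-((s - sigma |ϱ| p) * j)) := by
  obtain ⟨C, hC, h⟩ := exists_lintegral_block_rpow_le hp hq hX hf
  have h0 : ∀ (M : Fin n → ℤ) (j : ℕ), ∫⁻ x in dyadicCube 0 M, ‖block φ₀ f j x‖ₑ ^ p
      ≤ C * 2 ^ (-(j * s * p)) := fun M j => by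
    simpa using h 0 M j (by simp)
  have hmeas : ∀ j, Measurable fun x => ‖block φ₀ f j x‖ₑ ^ p := fun j =>
    (continuous_block φ₀ f j).enorm.measurable.pow_const p
  rcases le_or_gt 1 p with hp1 | hp1
  · refine ⟨1 + C, by finiteness, fun M j => ?_⟩
    have hσ : sigma |ϱ| p = 0 := by
      rw [sigma, max_eq_right ((div_le_one hp).2 hp1), sub_self, mul_zero]
    rw [hσ, sub_zero]
    -- splitting according to the size of the block replaces Hölder's inequality
    set a : ℝ≥0∞ := 2 ^ (-(s * j)) with ha
    have ha0 : a ≠ 0 := by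
      rw [ha, ne_eq, ENNReal.rpow_eq_zero_iff]; simp
    calc ∫⁻ x in dyadicCube 0 M, ‖block φ₀ f j x‖ₑ
        ≤ ∫⁻ x in dyadicCube 0 M, (a + ‖block φ₀ f j x‖ₑ ^ p * a ^ (1 - p)) :=
          lintegral_mono fun x => le_add_rpow_mul_rpow hp1 _ ha0 (two_rpow_ne_top _)
      _ = a + (∫⁻ x in dyadicCube 0 M, ‖block φ₀ f j x‖ₑ ^ p) * a ^ (1 - p) := by
          rw [lintegral_add_left measurable_const, setLIntegral_const, volume_dyadicCube_zero,
            mul_one, lintegral_mul_const _ (hmeas j)]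
      _ ≤ a + (C * 2 ^ (-(j * s * p))) * a ^ (1 - p) := by gcongr; exact h0 M j
      _ = (1 + C) * a := by
          rw [mul_assoc, ha, ← ENNReal.rpow_mul, ← two_rpow_add]
          ring_nf
  · obtain ⟨N, hN⟩ := exists_block_growth φ₀ f
    obtain ⟨B, hB, hlow⟩ := exists_fourier_lowpass_bound φ₀ (N + (n + 1))
    set K : ℝ≥0∞ := ENNReal.ofReal (B * 2 ^ n) *
      (ENNReal.ofReal ((1 + n) ^ (n + 1)) * decayMass n (n + 1) * C) with hK
    have hKtop : K ≠ ∞ := by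
      have := (decayMass_lt_top (n := n) (m := n + 1) (by omega)).ne
      finiteness
    have hsup : ∀ (j : ℕ) (x : E n),
        ‖block φ₀ f j x‖ₑ ^ p ≤ K * 2 ^ (-(j * (ϱ + s * p))) := by
      intro j x
      obtain ⟨C₀, hC₀, hgrowth⟩ := hN j
      have h1 := enorm_rpow_le_of_reproducing (continuous_block φ₀ f j) hC₀ hgrowth
        (κ := fun z => (𝓕 (lowpass φ₀ (j + 1)) : 𝓢(E n, ℂ)) z) (J := j) (by positivity)
        (block_eq_integral hφ₀ f j)
        (B := B * (2 ^ (j + 1)) ^ n) (by positivity) (fun z => ?_) hp hp1.le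
        (fun M => h j M j (by simp)) x
      · refine h1.trans_eq ?_
        have h2 : ENNReal.ofReal (B * (2 ^ (j + 1)) ^ n)
            = ENNReal.ofReal (B * 2 ^ n) * 2 ^ (j * n : ℝ) := by
          have h3 : (2 : ℝ≥0∞) ^ (j * n : ℝ) = ENNReal.ofReal ((2 ^ j) ^ n) := by
            rw [← pow_mul, ENNReal.ofReal_pow (by positivity), ENNReal.ofReal_ofNat,
              ← ENNReal.rpow_natCast]
            push_cast
            rfl
          rw [h3, ← ENNReal.ofReal_mul (by positivity)]
          congr 1
          rw [pow_succ, mul_pow]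
          ring
        rw [h2, hK]
        have h4 : (2 : ℝ≥0∞) ^ (-(j * (ϱ + s * p))) =
            2 ^ (j * n : ℝ) * 2 ^ (-((j : ℤ) * (n + ϱ) + j * s * p) : ℝ) := by
          rw [← two_rpow_add]
          congr 1
          push_cast
          ring
        rw [h4]
        ring
      · refine (hlow (j + 1) z).trans ?_
        rw [mul_assoc, zpow_natCast]
        gcongr
        · exact one_le_two
        · omega
    refine ⟨K ^ ((1 - p) / p) * C, ENNReal.mul_ne_top
      (ENNReal.rpow_ne_top_of_nonneg (div_nonneg (by linarith) hp.le) hKtop) hC, fun M j => ?_⟩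
    have hσ : sigma |ϱ| p = -ϱ * (1 - p) / p := by
      rw [sigma, max_eq_left ((one_le_div hp).2 hp1.le), abs_of_neg hϱ]
      field_simp
    set b : ℝ≥0∞ := (K * 2 ^ (-(j * (ϱ + s * p)))) ^ ((1 - p) / p) with hb
    calc ∫⁻ x in dyadicCube 0 M, ‖block φ₀ f j x‖ₑ
        ≤ ∫⁻ x in dyadicCube 0 M, b * ‖block φ₀ f j x‖ₑ ^ p := by
          refine lintegral_mono fun x => ?_
          calc ‖block φ₀ f j x‖ₑ
              = (‖block φ₀ f j x‖ₑ ^ p) ^ ((1 - p) / p) * ‖block φ₀ f j x‖ₑ ^ p := by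
                rw [← ENNReal.rpow_mul, mul_div_cancel₀ _ hp.ne',
                  ← ENNReal.rpow_add_of_nonneg _ _ (by linarith) hp.le, sub_add_cancel,
                  ENNReal.rpow_one]
            _ ≤ _ := by
                gcongr
                exact ENNReal.rpow_le_rpow (hsup j x) (div_nonneg (by linarith) hp.le)
      _ = b * ∫⁻ x in dyadicCube 0 M, ‖block φ₀ f j x‖ₑ ^ p := lintegral_const_mul _ (hmeas j)
      _ ≤ b * (C * 2 ^ (-(j * s * p))) := by gcongr; exact h0 M j
      _ = K ^ ((1 - p) / p) * C *
          (2 ^ (-(j * (ϱ + s * p)) * ((1 - p) / p)) * 2 ^ (-(j * s * p))) := by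
          rw [hb, ENNReal.mul_rpow_of_nonneg _ _ (div_nonneg (by linarith) hp.le),
            ← ENNReal.rpow_mul]
          ring
      _ = _ := by
          rw [← two_rpow_add, hσ]
          congr 2
          field_simp
          ring

/-- Above the critical smoothness every space of the clan consists of locally integrable
functions. -/
theorem clan_subset_L1loc {φ₀ : 𝓢(E n, ℂ)} (hφ₀ : IsGenerator φ₀) {s p ϱ : ℝ} {q : ℝ≥0∞}
    (hp : 0 < p) (hq : 0 < q) (hϱ : ϱ < 0) (hs : sigma |ϱ| p < s)
    {X : Set 𝓢'(E n, ℂ)} (hX : X ∈ clan n φ₀ ϱ s p q) : X ⊆ L1loc n := by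
  intro f hf
  obtain ⟨C, hC, h⟩ := exists_lintegral_block_le hφ₀ hp hq hϱ hX hf
  refine mem_L1loc_of_tsum_ne_top hφ₀ f (m := n + 1) ?_
  set K : ℝ≥0∞ := ENNReal.ofReal ((1 + n) ^ (n + 1)) * decayMass n (n + 1) with hK
  have hKtop : K ≠ ∞ := by
    have := (decayMass_lt_top (n := n) (m := n + 1) (by omega)).ne
    finiteness
  set r : ℝ≥0∞ := 2 ^ (-(s - sigma |ϱ| p)) with hr
  have hr1 : r < 1 := by
    exact ENNReal.rpow_lt_one_of_one_lt_of_neg ENNReal.one_lt_two (by linarith)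
  have hbd : ∀ j, ∫⁻ y, ‖block φ₀ f j y‖ₑ * decay (n + 1) ‖y‖ ≤ K * C * r ^ j := fun j => by
    have h1 := lintegral_mul_decay_le (n + 1) 0 (continuous_block φ₀ f j).enorm.measurable
      (fun M => h M j) 0
    simp only [zpow_zero, one_mul, sub_zero] at h1
    refine h1.trans_eq ?_
    rw [hr, ← ENNReal.rpow_mul_natCast, hK, neg_mul]
    ring
  refine ne_top_of_le_ne_top ?_ (ENNReal.tsum_le_tsum hbd)
  rw [ENNReal.tsum_mul_left, ENNReal.tsum_geometric]
  refine ENNReal.mul_ne_top (ENNReal.mul_ne_top hKtop hC) ?_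
  exact ENNReal.inv_ne_top.2 (tsub_pos_of_lt hr1).ne'

/-! ### A common sufficient condition for membership in the four spaces -/

theorem lqNorm_mono {q : ℝ≥0∞} {a b : ℕ → ℝ≥0∞} (h : ∀ j, a j ≤ b j) : lqNorm q a ≤ lqNorm q b := by
  unfold lqNorm
  split_ifs
  · exact iSup_mono h
  · gcongr with j
    exact h j

theorem lqNorm_const_mul {q : ℝ≥0∞} (hq : 0 < q) (c : ℝ≥0∞) (a : ℕ → ℝ≥0∞) :
    lqNorm q (fun j => c * a j) = c * lqNorm q a := by
  unfold lqNorm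
  split_ifs with h
  · rw [ENNReal.mul_iSup]
  · have ht : 0 < q.toReal := ENNReal.toReal_pos hq.ne' h
    simp_rw [ENNReal.mul_rpow_of_nonneg _ _ ht.le]
    rw [ENNReal.tsum_mul_left, ENNReal.mul_rpow_of_nonneg _ _ (by positivity), ← ENNReal.rpow_mul,
      mul_one_div_cancel ht.ne', ENNReal.rpow_one]

theorem lqNorm_geometric_ne_top {q : ℝ≥0∞} (hq : 0 < q) {ε : ℝ} (hε : 0 < ε) :
    lqNorm q (fun j => (2 : ℝ≥0∞) ^ (-(j * ε))) ≠ ∞ := by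
  unfold lqNorm
  split_ifs with h
  · refine ne_top_of_le_ne_top ENNReal.one_ne_top (iSup_le fun j => ?_)
    rw [← ENNReal.rpow_zero (x := 2)]
    exact ENNReal.rpow_le_rpow_of_exponent_le one_le_two (neg_nonpos.2 (by positivity))
  · have ht : 0 < q.toReal := ENNReal.toReal_pos hq.ne' h
    refine ENNReal.rpow_ne_top_of_nonneg (by positivity) ?_
    have h1 : ∀ j : ℕ, ((2 : ℝ≥0∞) ^ (-(j * ε))) ^ q.toReal = (2 ^ (-(ε * q.toReal))) ^ j :=
      fun j => by
        rw [← ENNReal.rpow_mul, ← ENNReal.rpow_mul_natCast]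
        ring_nf
    simp_rw [h1]
    rw [ENNReal.tsum_geometric]
    refine ENNReal.inv_ne_top.2 (tsub_pos_of_lt ?_).ne'
    exact ENNReal.rpow_lt_one_of_one_lt_of_neg ENNReal.one_lt_two (neg_lt_zero.2 (by positivity))

theorem lpNormOn_const_mul {p : ℝ} (hp : 0 < p) (A : Set (E n)) {c : ℝ≥0∞} (hc : c ≠ ∞)
    (g : E n → ℝ≥0∞) : lpNormOn p A (fun x => c * g x) = c * lpNormOn p A g := by
  unfold lpNormOn
  simp_rw [ENNReal.mul_rpow_of_nonneg _ _ hp.le]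
  rw [lintegral_const_mul' _ _ (ENNReal.rpow_ne_top_of_nonneg hp.le hc),
    ENNReal.mul_rpow_of_nonneg _ _ (by positivity), ← ENNReal.rpow_mul,
    mul_one_div_cancel hp.ne', ENNReal.rpow_one]

/-- Tonelli's theorem for `ℓ_p`-valued `L_p` functions. -/
theorem lpNormOn_lqNorm {p : ℝ} (hp : 0 < p) (A : Set (E n)) {g : ℕ → E n → ℝ≥0∞}
    (hg : ∀ j, Measurable (g j)) :
    lpNormOn p A (fun x => lqNorm (ENNReal.ofReal p) fun j => g j x)
      = lqNorm (ENNReal.ofReal p) fun j => lpNormOn p A (g j) := by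
  simp only [lpNormOn, lqNorm, ENNReal.ofReal_ne_top, if_false, ENNReal.toReal_ofReal hp.le]
  simp_rw [← ENNReal.rpow_mul, one_div_mul_cancel hp.ne', ENNReal.rpow_one]
  rw [lintegral_tsum fun j => ((hg j).pow_const p).aemeasurable]

theorem le_morreyNorm (ϱ p : ℝ) (g : E n → ℝ≥0∞) (J : ℤ) (M : Fin n → ℤ) :
    morreyWeight n ϱ p J * lpNormOn p (dyadicCube J M) g ≤ morreyNorm ϱ p g :=
  le_iSup₂_of_le J M le_rfl

theorem tail_le (J : ℤ) (a : ℕ → ℝ≥0∞) (j : ℕ) : tail J a j ≤ a j := by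
  unfold tail
  split_ifs <;> simp

theorem measurable_wblock (φ₀ : 𝓢(E n, ℂ)) (s : ℝ) (f : 𝓢'(E n, ℂ)) (j : ℕ) :
    Measurable (wblock φ₀ s f j) :=
  (continuous_block φ₀ f j).enorm.measurable.const_mul _

theorem wblock_add (φ₀ : 𝓢(E n, ℂ)) (s t : ℝ) (f : 𝓢'(E n, ℂ)) (j : ℕ) (x : E n) :
    wblock φ₀ (s + t) f j x = 2 ^ (j * t) * wblock φ₀ s f j x := by
  rw [wblock, wblock, mul_add, add_comm, two_rpow_add, mul_assoc]

theorem morreyWeight_mul_lpNormOn_wblock_le {φ₀ : 𝓢(E n, ℂ)} {s s₁ p ϱ : ℝ} (hp : 0 < p)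
    {f : 𝓢'(E n, ℂ)} {C : ℝ≥0∞}
    (h : ∀ j : ℕ, morreyNorm ϱ p (fun x => ‖block φ₀ f j x‖ₑ) ≤ C * 2 ^ (-(j * s₁)))
    (J : ℤ) (M : Fin n → ℤ) (j : ℕ) :
    morreyWeight n ϱ p J * lpNormOn p (dyadicCube J M) (wblock φ₀ s f j)
      ≤ C * 2 ^ (-(j * (s₁ - s))) :=
  calc _ = 2 ^ (j * s) * (morreyWeight n ϱ p J *
        lpNormOn p (dyadicCube J M) fun x => ‖block φ₀ f j x‖ₑ) := by
        unfold wblock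
        rw [lpNormOn_const_mul hp _ (two_rpow_ne_top _), mul_left_comm]
    _ ≤ 2 ^ (j * s) * (C * 2 ^ (-(j * s₁))) := by
        exact mul_le_mul_right ((le_morreyNorm ϱ p _ J M).trans (h j)) _
    _ = C * 2 ^ (-(j * (s₁ - s))) := by
        rw [mul_left_comm, ← two_rpow_add]
        ring_nf

/-- A geometric gain in the Morrey norms of the blocks makes the fine index `q` and the order of
the norms irrelevant. -/
theorem mem_of_morreyNorm_block_le {φ₀ : 𝓢(E n, ℂ)} {s s₁ p ϱ : ℝ} {q : ℝ≥0∞} (hp : 0 < p)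
    (hq : 0 < q) (hs : s < s₁) {f : 𝓢'(E n, ℂ)} {C : ℝ≥0∞} (hC : C ≠ ∞)
    (h : ∀ j : ℕ, morreyNorm ϱ p (fun x => ‖block φ₀ f j x‖ₑ) ≤ C * 2 ^ (-(j * s₁)))
    {X : Set 𝓢'(E n, ℂ)} (hX : X ∈ clan n φ₀ ϱ s p q) : f ∈ X := by
  have hB : lowerBNorm φ₀ ϱ s p q f < ∞ := by
    refine lt_of_le_of_lt (lqNorm_mono fun j => iSup₂_le fun J M =>
      morreyWeight_mul_lpNormOn_wblock_le hp h J M j) ?_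
    rw [lqNorm_const_mul hq]
    exact ENNReal.mul_lt_top hC.lt_top (lqNorm_geometric_ne_top hq (by linarith)).lt_top
  have hF : lowerFNorm φ₀ ϱ s p q f < ∞ := by
    have hε : 0 < (s₁ - s) / 2 := by linarith
    set ε := (s₁ - s) / 2 with hε_def
    have hp' : 0 < ENNReal.ofReal p := ENNReal.ofReal_pos.2 hp
    set K := lqNorm q (fun j => (2 : ℝ≥0∞) ^ (-(j * ε))) with hK
    have hKtop : K ≠ ∞ := lqNorm_geometric_ne_top hq hε
    set G : E n → ℝ≥0∞ := fun x => lqNorm (ENNReal.ofReal p) fun j => wblock φ₀ (s + ε) f j x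
      with hG
    -- half of the gain controls the `ℓ_q` norm by the `ℓ_p` norm, which commutes with `L_p`
    have hpt : ∀ x, lqNorm q (fun j => wblock φ₀ s f j x) ≤ K * G x := fun x => by
      rw [mul_comm, hK, ← lqNorm_const_mul hq]
      refine lqNorm_mono fun j => ?_
      refine le_mul_two_rpow_neg ?_
      rw [← wblock_add]
      exact le_lqNorm hp' (fun j => wblock φ₀ (s + ε) f j x) j
    refine lt_of_le_of_lt (b := K * (C * lqNorm (ENNReal.ofReal p) fun j => 2 ^ (-(j * ε))))
      (iSup₂_le fun J M => ?_) ?_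
    · refine le_trans (mul_le_mul_right (lpNormOn_mono hp _ hpt) _) ?_
      rw [lpNormOn_const_mul hp _ hKtop, mul_left_comm]
      refine mul_le_mul_right ?_ _
      rw [hG, lpNormOn_lqNorm hp _ fun j => measurable_wblock φ₀ (s + ε) f j,
        ← lqNorm_const_mul hp', ← lqNorm_const_mul hp']
      refine lqNorm_mono fun j => (morreyWeight_mul_lpNormOn_wblock_le hp h J M j).trans_eq ?_
      rw [hε_def]
      ring_nf
    · exact ENNReal.mul_lt_top hKtop.lt_top (ENNReal.mul_lt_top hC.lt_top
        (lqNorm_geometric_ne_top hp' hε).lt_top)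
  simp only [clan, Set.mem_insert_iff, Set.mem_singleton_iff] at hX
  rcases hX with rfl | rfl | rfl | rfl
  · exact hB
  · refine lt_of_le_of_lt (iSup₂_le fun J M => ?_) hB
    rw [← lqNorm_const_mul hq]
    refine lqNorm_mono fun j => ?_
    refine le_trans (mul_le_mul_right (tail_le J _ j) _) ?_
    exact le_morreyNorm ϱ p _ J M
  · exact hF
  · refine lt_of_le_of_lt (iSup₂_mono fun J M => ?_) hF
    gcongr
    exact lpNormOn_mono hp _ fun x => lqNorm_mono fun j => tail_le J _ j

/-! ### Lacunary superpositions of wave packets -/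

/-- A bounded measurable function is the Fourier transform of a tempered distribution. -/
theorem exists_fourier_eq_of_bounded {F : E n → ℂ} (hF : Measurable F) {B : ℝ}
    (hB : ∀ η, ‖F η‖ ≤ B) : ∃ f : 𝓢'(E n, ℂ), ∀ ψ, f ψ = ∫ η, F η * 𝓕⁻ ψ η := by
  have hL : MemLp F ∞ volume := memLp_top_of_bound hF.aestronglyMeasurable B (ae_of_all _ hB)
  refine ⟨𝓕⁻ (Lp.toTemperedDistribution (hL.toLp F)), fun ψ => ?_⟩
  rw [TemperedDistribution.fourierInv_apply, Lp.toTemperedDistribution_apply]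
  refine integral_congr_ae ?_
  filter_upwards [hL.coeFn_toLp] with η hη
  rw [hη, smul_eq_mul, mul_comm]

/-- The points with coordinates in `N⁻¹ ℤ` of the unit cube `[0,1)ⁿ`. -/
noncomputable def gridPoint (N : ℕ) (m : Fin n → Fin N) : E n :=
  WithLp.toLp 2 fun i => (m i : ℝ) / N

/-- The Fourier transform of the normalized counting measure of the grid. -/
noncomputable def gridFourier (N : ℕ) (η : E n) : ℂ :=
  ((N : ℂ) ^ n)⁻¹ * ∑ m : Fin n → Fin N,
    Complex.exp (↑(-2 * Real.pi * inner ℝ (gridPoint N m) η) * Complex.I)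

/-- A cut-off function at frequencies of modulus at most `2^j / 8`, in the frequency variable of
`symbol`. -/
noncomputable def bump (φ₀ : 𝓢(E n, ℂ)) (j : ℕ) : 𝓢(E n, ℂ) :=
  dilate ((2 : ℝ)⁻¹ ^ j) (by positivity) (dilate (12 * (2 * Real.pi)) (by positivity) φ₀)

/-- The frequency in direction `e` that corresponds to the modulus `7/8 * 2^j`. -/
noncomputable def center (e : E n) (j : ℕ) : E n := (7 / 8 * 2 ^ j / (2 * Real.pi)) • e

/-- The Fourier transform of a sum of wave packets of frequency `center e j` which are concentrated
at the points of the grid of mesh size `1 / N`. -/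
noncomputable def packet (φ₀ : 𝓢(E n, ℂ)) (e : E n) (j N : ℕ) (η : E n) : ℂ :=
  bump φ₀ j (η - center e j) * gridFourier N (η - center e j)

theorem bump_apply (φ₀ : 𝓢(E n, ℂ)) (j : ℕ) (η : E n) :
    bump φ₀ j η = φ₀ ((12 * (2 * Real.pi)) • (2 : ℝ)⁻¹ ^ j • η) := rfl

theorem continuous_gridFourier (N : ℕ) : Continuous (gridFourier (n := n) N) := by
  unfold gridFourier
  fun_prop

theorem norm_gridFourier_le {N : ℕ} (hN : 0 < N) (η : E n) : ‖gridFourier N η‖ ≤ 1 := by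
  have hN' : (0 : ℝ) < N := by exact_mod_cast hN
  rw [gridFourier, norm_mul, norm_inv, norm_pow, Complex.norm_natCast,
    inv_mul_le_iff₀ (by positivity), mul_one]
  refine (norm_sum_le _ _).trans (le_of_eq ?_)
  simp_rw [Complex.norm_exp_ofReal_mul_I]
  simp

theorem continuous_packet (φ₀ : 𝓢(E n, ℂ)) (e : E n) (j N : ℕ) :
    Continuous (packet φ₀ e j N) := by
  have h1 := continuous_gridFourier (n := n) N
  have h2 := (bump φ₀ j).continuous
  unfold packet
  fun_prop

theorem norm_pi_smul (η : E n) : ‖(2 * Real.pi) • η‖ = 2 * Real.pi * ‖η‖ := by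
  rw [norm_smul, Real.norm_of_nonneg (by positivity)]

theorem norm_half_pow_smul (k : ℕ) (η : E n) : ‖(2 : ℝ)⁻¹ ^ k • η‖ = ‖η‖ / 2 ^ k := by
  rw [norm_smul, Real.norm_of_nonneg (by positivity), inv_pow]
  field_simp

theorem norm_center {e : E n} (he : ‖e‖ = 1) (j : ℕ) :
    ‖(2 * Real.pi) • center e j‖ = 7 / 8 * 2 ^ j := by
  rw [norm_pi_smul, center, norm_smul, he, mul_one, Real.norm_of_nonneg (by positivity)]
  field_simp

theorem norm_mem_Ioo_of_near_center {e : E n} (he : ‖e‖ = 1) {j : ℕ} {η : E n}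
    (h : ‖(2 * Real.pi) • (η - center e j)‖ < 2 ^ j / 8) :
    3 / 4 * 2 ^ j < ‖(2 * Real.pi) • η‖ ∧ ‖(2 * Real.pi) • η‖ < 2 ^ j := by
  have h1 := norm_center he j
  have h2 := abs_norm_sub_norm_le ((2 * Real.pi) • η) ((2 * Real.pi) • center e j)
  rw [← smul_sub, h1, abs_le] at h2
  constructor <;> linarith [h2.1, h2.2]

theorem symbol_eq_of_norm_mem_Ioo {φ₀ : 𝓢(E n, ℂ)} (hφ₀ : IsGenerator φ₀) {j : ℕ} {η : E n}
    (h1 : 3 / 4 * 2 ^ j < ‖(2 * Real.pi) • η‖) (h2 : ‖(2 * Real.pi) • η‖ < 2 ^ j) (k : ℕ) :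
    symbol φ₀ k η = if k = j then 1 else 0 := by
  have hlow : ∀ k, φ₀ ((2 : ℝ)⁻¹ ^ k • (2 * Real.pi) • η) = if j ≤ k then 1 else 0 := by
    intro k
    split_ifs with hk
    · apply hφ₀.eq_one
      rw [norm_half_pow_smul, div_le_one (by positivity)]
      exact h2.le.trans (pow_le_pow_right₀ one_le_two hk)
    · apply hφ₀.eq_zero
      rw [norm_half_pow_smul, le_div_iff₀ (by positivity)]
      have h3 : (2 : ℝ) ^ (k + 1) ≤ 2 ^ j := pow_le_pow_right₀ one_le_two (by omega)
      rw [pow_succ] at h3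
      linarith
  cases k with
  | zero =>
    have := hlow 0
    rw [pow_zero, one_smul] at this
    rw [symbol_zero_apply, this]
    simp [eq_comm]
  | succ k =>
    rw [symbol_succ_apply, hlow, hlow]
    by_cases h3 : j ≤ k
    · simp [h3, show j ≤ k + 1 by omega, show k + 1 ≠ j by omega]
    · by_cases h4 : j = k + 1
      · simp [h4]
      · simp [h3, show ¬ j ≤ k + 1 by omega, show k + 1 ≠ j by omega]

theorem bump_eq_zero {φ₀ : 𝓢(E n, ℂ)} (hφ₀ : IsGenerator φ₀) {j : ℕ} {η : E n}
    (h : 2 ^ j / 8 ≤ ‖(2 * Real.pi) • η‖) : bump φ₀ j η = 0 := by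
  rw [bump_apply]
  apply hφ₀.eq_zero
  rw [norm_pi_smul] at h
  rw [norm_smul, norm_half_pow_smul, Real.norm_of_nonneg (by positivity), ← mul_div_assoc,
    le_div_iff₀ (by positivity)]
  linarith

/-- The packets of index `j` live where the symbol of index `j` is the only one which does not
vanish. -/
theorem symbol_mul_packet {φ₀ : 𝓢(E n, ℂ)} (hφ₀ : IsGenerator φ₀) {e : E n} (he : ‖e‖ = 1)
    (k j N : ℕ) (η : E n) :
    symbol φ₀ k η * packet φ₀ e j N η = if k = j then packet φ₀ e j N η else 0 := by
  rcases lt_or_ge ‖(2 * Real.pi) • (η - center e j)‖ (2 ^ j / 8) with h | h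
  · obtain ⟨h1, h2⟩ := norm_mem_Ioo_of_near_center he h
    rw [symbol_eq_of_norm_mem_Ioo hφ₀ h1 h2]
    split_ifs <;> simp
  · simp [packet, bump_eq_zero hφ₀ h]

/-- The superposition of the wave packets of all frequencies `center e j`, with mesh sizes
`1 / N j`, on the Fourier side. -/
noncomputable def packetSum (φ₀ : 𝓢(E n, ℂ)) (e : E n) (N : ℕ → ℕ) (η : E n) : ℂ :=
  ∑' j, packet φ₀ e j (N j) η

theorem measurable_packetSum (φ₀ : 𝓢(E n, ℂ)) (e : E n) (N : ℕ → ℕ) :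
    Measurable (packetSum φ₀ e N) := by
  unfold packetSum
  exact Measurable.tsum fun j => (continuous_packet φ₀ e j (N j)).measurable

theorem symbol_mul_packetSum {φ₀ : 𝓢(E n, ℂ)} (hφ₀ : IsGenerator φ₀) {e : E n} (he : ‖e‖ = 1)
    (N : ℕ → ℕ) (k : ℕ) (η : E n) :
    symbol φ₀ k η * packetSum φ₀ e N η = packet φ₀ e k (N k) η := by
  rw [packetSum, ← tsum_mul_left]
  simp_rw [symbol_mul_packet hφ₀ he]
  exact (tsum_eq_single k fun j hj => if_neg hj.symm).trans (if_pos rfl)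

theorem packetSum_eq {φ₀ : 𝓢(E n, ℂ)} (hφ₀ : IsGenerator φ₀) {e : E n} (he : ‖e‖ = 1)
    (N : ℕ → ℕ) {j : ℕ} {η : E n} (h : ‖(2 * Real.pi) • (η - center e j)‖ < 2 ^ j / 8) :
    packetSum φ₀ e N η = packet φ₀ e j (N j) η := by
  obtain ⟨h1, h2⟩ := norm_mem_Ioo_of_near_center he h
  rw [← symbol_mul_packetSum hφ₀ he, symbol_eq_of_norm_mem_Ioo hφ₀ h1 h2, if_pos rfl, one_mul]

theorem exists_packetSum_bound {φ₀ : 𝓢(E n, ℂ)} (hφ₀ : IsGenerator φ₀) {e : E n} (he : ‖e‖ = 1)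
    {N : ℕ → ℕ} (hN : ∀ j, 0 < N j) : ∃ B : ℝ, ∀ η, ‖packetSum φ₀ e N η‖ ≤ B := by
  obtain ⟨B, hB0, hB⟩ := exists_one_add_norm_bound φ₀ 0
  refine ⟨B, fun η => ?_⟩
  by_cases h : ∃ j, ‖(2 * Real.pi) • (η - center e j)‖ < 2 ^ j / 8
  · obtain ⟨j, hj⟩ := h
    rw [packetSum_eq hφ₀ he N hj, packet, norm_mul, bump_apply]
    have h1 := hB ((12 * (2 * Real.pi)) • (2 : ℝ)⁻¹ ^ j • (η - center e j))
    have h2 := norm_gridFourier_le (hN j) (η - center e j)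
    rw [pow_zero, inv_one, mul_one] at h1
    calc _ ≤ B * 1 := by gcongr
      _ = B := mul_one B
  · push Not at h
    have h0 : ∀ j, packet φ₀ e j (N j) η = 0 := fun j => by
      rw [packet, bump_eq_zero hφ₀ (h j), zero_mul]
    rw [packetSum]
    simp [h0, hB0]

/-- The wave packet of frequency zero is concentrated near the origin at scale `2⁻ʲ`. -/
theorem exists_fourierInv_bump_bound (φ₀ : 𝓢(E n, ℂ)) (m : ℕ) :
    ∃ C : ℝ, 0 ≤ C ∧ ∀ (j : ℕ) (x : E n),
      ‖𝓕⁻ (bump φ₀ j) x‖ ≤ C * (2 ^ j) ^ n * ((1 + 2 ^ j * ‖x‖) ^ m)⁻¹ := by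
  obtain ⟨C, hC0, hC⟩ := exists_one_add_norm_bound
    (𝓕 (dilate (12 * (2 * Real.pi)) (by positivity) φ₀ : 𝓢(E n, ℂ))) m
  refine ⟨C, hC0, fun j x => ?_⟩
  have h1 : 𝓕⁻ (bump φ₀ j) x = 𝓕 (bump φ₀ j) (-x) := by
    rw [SchwartzMap.fourierInv_coe, SchwartzMap.fourier_coe, Real.fourierInv_eq_fourier_neg]
  have h2 := hC ((2 : ℝ) ^ j • (-x))
  rw [norm_smul, norm_neg, Real.norm_of_nonneg (by positivity)] at h2
  rw [h1, bump, fourier_dilate _ (by positivity), norm_mul, Complex.norm_real,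
    Real.norm_of_nonneg (by positivity), ← inv_pow, inv_inv]
  calc _ ≤ ((2 : ℝ) ^ j) ^ n * (C * ((1 + 2 ^ j * ‖x‖) ^ m)⁻¹) := by gcongr
    _ = _ := by ring

theorem fourierInv_gridFourier_mul (g : 𝓢(E n, ℂ)) (N : ℕ) (x : E n) :
    ∫ η, g η * gridFourier N η * Complex.exp (↑(2 * Real.pi * inner ℝ x η) * Complex.I)
      = ((N : ℂ) ^ n)⁻¹ * ∑ m : Fin n → Fin N, 𝓕⁻ g (x - gridPoint N m) := by
  have h : ∀ m : Fin n → Fin N, 𝓕⁻ g (x - gridPoint N m) =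
      ∫ η, g η * Complex.exp (↑(-2 * Real.pi * inner ℝ (gridPoint N m) η) * Complex.I) *
        Complex.exp (↑(2 * Real.pi * inner ℝ x η) * Complex.I) := fun m => by
    rw [SchwartzMap.fourierInv_coe, Real.fourierInv_eq']
    congr 1
    ext1 η
    rw [smul_eq_mul, mul_assoc (g η), ← Complex.exp_add, mul_comm, real_inner_comm, inner_sub_left]
    congr 2
    push_cast
    ring
  simp_rw [h]
  rw [← integral_finsetSum, ← integral_const_mul]
  · congr 1
    ext1 η
    rw [gridFourier, Finset.mul_sum, Finset.mul_sum, Finset.mul_sum, Finset.sum_mul]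
    refine Finset.sum_congr rfl fun m _ => ?_
    ring
  · intro m _
    refine g.integrable.mono (by fun_prop) (ae_of_all _ fun η => ?_)
    rw [norm_mul, norm_mul, Complex.norm_exp_ofReal_mul_I, Complex.norm_exp_ofReal_mul_I, mul_one,
      mul_one]

/-- The blocks of the superposition are the individual sums of wave packets. -/
theorem norm_block_of_fourier_eq_packetSum {φ₀ : 𝓢(E n, ℂ)} (hφ₀ : IsGenerator φ₀) {e : E n}
    (he : ‖e‖ = 1) {N : ℕ → ℕ} {f : 𝓢'(E n, ℂ)}
    (hf : ∀ ψ, f ψ = ∫ η, packetSum φ₀ e N η * 𝓕⁻ ψ η) (j : ℕ) (x : E n) :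
    ‖block φ₀ f j x‖ =
      ‖((N j : ℂ) ^ n)⁻¹ * ∑ m : Fin n → Fin (N j), 𝓕⁻ (bump φ₀ j) (x - gridPoint (N j) m)‖ := by
  have h : block φ₀ f j x = Complex.exp (↑(2 * Real.pi * inner ℝ x (center e j)) * Complex.I) *
      ∫ η, bump φ₀ j η * gridFourier (N j) η *
        Complex.exp (↑(2 * Real.pi * inner ℝ x η) * Complex.I) := by
    rw [block, hf, ← integral_add_right_eq_self _ (center e j), ← integral_const_mul]
    congr 1
    ext1 η
    have h1 : Complex.exp (↑(2 * Real.pi * inner ℝ x (η + center e j)) * Complex.I) =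
        Complex.exp (↑(2 * Real.pi * inner ℝ x (center e j)) * Complex.I) *
          Complex.exp (↑(2 * Real.pi * inner ℝ x η) * Complex.I) := by
      rw [← Complex.exp_add, inner_add_right]
      congr 1
      push_cast
      ring
    rw [fourierInv_translate, FourierTransform.fourierInv_fourier_eq, mul_left_comm,
      mul_comm (packetSum _ _ _ _), symbol_mul_packetSum hφ₀ he, packet, add_sub_cancel_right, h1]
    ring
  rw [h, fourierInv_gridFourier_mul, norm_mul, Complex.norm_exp_ofReal_mul_I, one_mul]

/-! ### The superposition is not locally integrable -/

theorem gridPoint_mem {N : ℕ} (m : Fin n → Fin N) (i : Fin n) :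
    0 ≤ gridPoint N m i ∧ gridPoint N m i < 1 := by
  have hm : ((m i : ℕ) : ℝ) < N := by exact_mod_cast (m i).2
  have hN : (0 : ℝ) < N := lt_of_le_of_lt (by positivity) hm
  exact ⟨by simp only [gridPoint]; positivity, by simp only [gridPoint]; rwa [div_lt_one hN]⟩

theorem norm_gridPoint_le {N : ℕ} (m : Fin n → Fin N) : ‖gridPoint N m‖ ≤ n * 2 := by
  have h1 : gridPoint N m ∈ cube (WithLp.toLp 2 fun _ : Fin n => (-1 : ℝ)) 2 := fun i => by
    have := gridPoint_mem m i
    constructor <;> simp only <;> linarith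
  have h2 : (0 : E n) ∈ cube (WithLp.toLp 2 fun _ : Fin n => (-1 : ℝ)) 2 := fun i => by
    constructor <;> simp
  simpa using norm_sub_le_of_mem_cube h1 h2

/-- A compactly supported Schwartz function which equals `1` at all grid points. -/
theorem exists_cutoff {φ₀ : 𝓢(E n, ℂ)} (hφ₀ : IsGenerator φ₀) :
    ∃ ψ : 𝓢(E n, ℂ), HasCompactSupport ψ ∧
      ∀ (N : ℕ) (m : Fin n → Fin N), ψ (gridPoint N m) = 1 := by
  have hc : (0 : ℝ) < ((n : ℝ) * 2 + 1)⁻¹ := by positivity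
  refine ⟨dilate _ hc.ne' φ₀, ?_, fun N m => ?_⟩
  · refine HasCompactSupport.intro (isCompact_closedBall (0 : E n) (3 / 2 * (n * 2 + 1)))
      fun x hx => ?_
    rw [dilate_apply]
    apply hφ₀.eq_zero
    rw [mem_closedBall_zero_iff, not_le] at hx
    rw [norm_smul, Real.norm_of_nonneg hc.le, le_inv_mul_iff₀ (by positivity)]
    linarith
  · rw [dilate_apply]
    apply hφ₀.eq_one
    rw [norm_smul, Real.norm_of_nonneg hc.le, inv_mul_le_iff₀ (by positivity)]
    linarith [norm_gridPoint_le m]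

theorem integral_gridFourier_mul {N : ℕ} (hN : 0 < N) {ψ : 𝓢(E n, ℂ)}
    (hψ : ∀ m : Fin n → Fin N, ψ (gridPoint N m) = 1) :
    ∫ η, gridFourier N η * 𝓕⁻ ψ η = 1 := by
  have h := fourierInv_gridFourier_mul (𝓕⁻ (compSubConstCLM ℂ 0 ψ)) N 0
  have h0 : compSubConstCLM ℂ 0 ψ = ψ := by
    ext x
    rw [compSubConstCLM_apply, sub_zero]
  rw [h0] at h
  have h1 : ∀ m : Fin n → Fin N, 𝓕⁻ (𝓕⁻ ψ) (0 - gridPoint N m) = 1 := fun m => by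
    rw [SchwartzMap.fourierInv_coe, Real.fourierInv_eq_fourier_neg, zero_sub, neg_neg,
      ← SchwartzMap.fourier_coe, FourierTransform.fourier_fourierInv_eq, hψ]
  have hN' : (N : ℂ) ≠ 0 := by exact_mod_cast hN.ne'
  simp_rw [h1] at h
  simp only [inner_zero_left, mul_zero, Complex.ofReal_zero, zero_mul, Complex.exp_zero, mul_one,
    Finset.sum_const, Finset.card_univ, Fintype.card_pi_const, Fintype.card_fin, nsmul_eq_mul,
    Nat.cast_pow, inv_mul_cancel₀ (pow_ne_zero n hN')] at h
  rw [← h]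
  simp_rw [mul_comm]

theorem tendsto_center_cocompact {e : E n} (he : ‖e‖ = 1) :
    Filter.Tendsto (center e) Filter.atTop (Filter.cocompact (E n)) := by
  rw [← Metric.cobounded_eq_cocompact, ← tendsto_norm_atTop_iff_cobounded]
  have h : ∀ j, ‖center e j‖ = 7 / 8 / (2 * Real.pi) * 2 ^ j := fun j => by
    rw [center, norm_smul, he, mul_one, Real.norm_of_nonneg (by positivity)]
    ring
  simp_rw [h]
  exact (tendsto_pow_atTop_atTop_of_one_lt one_lt_two).const_mul_atTop (by positivity)

theorem tendsto_packetSum_center {φ₀ : 𝓢(E n, ℂ)} (hφ₀ : IsGenerator φ₀) {e : E n} (he : ‖e‖ = 1)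
    (N : ℕ → ℕ) (η : E n) :
    ∀ᶠ j in Filter.atTop, packetSum φ₀ e N (η + center e j) = gridFourier (N j) η := by
  have h : ∀ᶠ j : ℕ in Filter.atTop, 12 * ‖(2 * Real.pi) • η‖ < (2 : ℝ) ^ j :=
    (tendsto_pow_atTop_atTop_of_one_lt one_lt_two).eventually_gt_atTop _
  filter_upwards [h] with j hj
  have hnear : ‖(2 * Real.pi) • (η + center e j - center e j)‖ < 2 ^ j / 8 := by
    rw [add_sub_cancel_right]
    linarith [norm_nonneg ((2 * Real.pi) • η)]
  rw [packetSum_eq hφ₀ he N hnear, packet, add_sub_cancel_right, bump_apply, hφ₀.eq_one, one_mul]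
  rw [norm_pi_smul] at hj
  rw [norm_smul, norm_half_pow_smul, Real.norm_of_nonneg (by positivity), ← mul_div_assoc,
    div_le_one (by positivity)]
  linarith

/-- Modulated to the frequency `center e j`, the superposition has asymptotically mean one, which
contradicts the Riemann-Lebesgue lemma for locally integrable functions. -/
theorem notMem_L1loc_of_fourier_eq_packetSum {φ₀ : 𝓢(E n, ℂ)} (hφ₀ : IsGenerator φ₀) {e : E n}
    (he : ‖e‖ = 1) {N : ℕ → ℕ} (hN : ∀ j, 0 < N j) {f : 𝓢'(E n, ℂ)}
    (hf : ∀ ψ, f ψ = ∫ η, packetSum φ₀ e N η * 𝓕⁻ ψ η) : f ∉ L1loc n := by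
  rintro ⟨g, -, hg⟩
  obtain ⟨ψ, hψc, hψ⟩ := exists_cutoff hφ₀
  have hmod : ∀ (j : ℕ) (x : E n), 𝓕 (compSubConstCLM ℂ (center e j) (𝓕⁻ ψ)) x =
      Complex.exp (↑(-2 * Real.pi * inner ℝ (center e j) x) * Complex.I) * ψ x := fun j x => by
    rw [fourier_translate, FourierTransform.fourier_fourierInv_eq]
  -- on the function side the test integrals are Fourier coefficients of `g * ψ`
  have h0 : Filter.Tendsto (fun j => f (𝓕 (compSubConstCLM ℂ (center e j) (𝓕⁻ ψ))))
      Filter.atTop (nhds 0) := by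
    refine ((_root_.tendsto_integral_exp_inner_smul_cocompact (V := E n)
      (fun x => g x * ψ x)).comp (tendsto_center_cocompact he)).congr fun j => ?_
    rw [hg]
    · refine integral_congr_ae (ae_of_all _ fun x => ?_)
      simp only [hmod]
      rw [Circle.smul_def, Real.fourierChar_apply, smul_eq_mul, real_inner_comm, mul_left_comm]
      congr 3
      push_cast
      ring
    · refine hψc.mono fun x hx hx' => hx ?_
      rw [hmod, hx', mul_zero]
  obtain ⟨B, hB⟩ := exists_packetSum_bound hφ₀ he hN
  -- on the frequency side they approach the mean of `ψ` over the grid points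
  have h1 : Filter.Tendsto (fun j => f (𝓕 (compSubConstCLM ℂ (center e j) (𝓕⁻ ψ))) - 1)
      Filter.atTop (nhds 0) := by
    have h2 : ∀ j, f (𝓕 (compSubConstCLM ℂ (center e j) (𝓕⁻ ψ))) - 1 =
        ∫ η, (packetSum φ₀ e N (η + center e j) - gridFourier (N j) η) * 𝓕⁻ ψ η := fun j => by
      rw [hf, ← integral_gridFourier_mul (hN j) (hψ (N j)),
        ← integral_add_right_eq_self _ (center e j), ← integral_sub]
      · refine integral_congr_ae (ae_of_all _ fun η => ?_)
        simp only [FourierTransform.fourierInv_fourier_eq]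
        rw [compSubConstCLM_apply, add_sub_cancel_right, sub_mul]
      · simp only [FourierTransform.fourierInv_fourier_eq, compSubConstCLM_apply,
          add_sub_cancel_right]
        refine (𝓕⁻ ψ).integrable.bdd_mul (c := B) ?_ (ae_of_all _ fun η => hB _)
        exact ((measurable_packetSum φ₀ e N).comp (measurable_add_const _)).aestronglyMeasurable
      · exact (𝓕⁻ ψ).integrable.bdd_mul (c := 1) (continuous_gridFourier _).aestronglyMeasurable
          (ae_of_all _ fun η => norm_gridFourier_le (hN j) η)
    simp_rw [h2]
    have h3 := tendsto_integral_of_dominated_convergence (μ := (volume : Measure (E n)))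
      (F := fun j η => (packetSum φ₀ e N (η + center e j) - gridFourier (N j) η) * 𝓕⁻ ψ η)
      (f := fun _ => 0) (fun η => (B + 1) * ‖𝓕⁻ ψ η‖) (fun j => ?_) ?_ (fun j => ?_) ?_
    · simpa using h3
    · refine Measurable.aestronglyMeasurable ?_
      refine Measurable.mul (Measurable.sub ?_ ?_) (𝓕⁻ ψ).continuous.measurable
      · exact (measurable_packetSum φ₀ e N).comp (measurable_add_const _)
      · exact (continuous_gridFourier _).measurable
    · exact (𝓕⁻ ψ).integrable.norm.const_mul _
    · refine ae_of_all _ fun η => ?_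
      rw [norm_mul]
      gcongr
      exact (norm_sub_le _ _).trans (add_le_add (hB _) (norm_gridFourier_le (hN j) η))
    · refine ae_of_all _ fun η => ?_
      refine tendsto_const_nhds.congr' ?_
      filter_upwards [tendsto_packetSum_center hφ₀ he N η] with j hj
      rw [hj, sub_self, zero_mul]
  have h4 := tendsto_nhds_unique h1 (h0.sub_const 1)
  norm_num at h4

/-! ### Counting grid points in cubes -/

theorem card_filter_grid_le {N : ℕ} (hN : 0 < N) (u : ℝ) {L : ℝ} (hL : 0 ≤ L) :
    ((Finset.univ.filter fun k : Fin N => u < (k : ℝ) / N ∧ (k : ℝ) / N < u + L).card : ℝ)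
      ≤ N * L + 1 := by
  have hN' : (0 : ℝ) < N := by exact_mod_cast hN
  have h : (Finset.univ.filter fun k : Fin N => u < (k : ℝ) / N ∧ (k : ℝ) / N < u + L).card ≤
      (Finset.Ioo ⌊N * u⌋ ⌈N * u + N * L⌉).card := by
    refine Finset.card_le_card_of_injOn (fun k => ((k : ℕ) : ℤ)) (fun k hk => ?_) ?_
    · simp only [Finset.coe_filter, Finset.mem_univ, true_and, Set.mem_ofPred_eq, lt_div_iff₀ hN',
        div_lt_iff₀ hN'] at hk
      simp only [Finset.coe_Ioo, Set.mem_Ioo, Int.floor_lt, Int.lt_ceil, Int.cast_natCast]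
      constructor <;> linarith [hk.1, hk.2]
    · intro k _ l _ hkl
      exact Fin.ext (Int.ofNat_inj.1 hkl)
  have h1 : ((⌈N * u + N * L⌉ - ⌊N * u⌋ - 1 : ℤ) : ℝ) ≤ N * L + 1 := by
    push_cast
    linarith [Int.ceil_lt_add_one (N * u + N * L), Int.sub_one_lt_floor (N * u)]
  rw [Int.card_Ioo] at h
  refine le_trans (b := (((⌈N * u + N * L⌉ - ⌊N * u⌋ - 1).toNat : ℕ) : ℝ)) (by exact_mod_cast h) ?_
  rcases le_total 0 (⌈N * u + N * L⌉ - ⌊N * u⌋ - 1) with h2 | h2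
  · have h3 : (((⌈N * u + N * L⌉ - ⌊N * u⌋ - 1).toNat : ℕ) : ℝ) =
        ((⌈N * u + N * L⌉ - ⌊N * u⌋ - 1 : ℤ) : ℝ) := by
      rw [← Int.cast_natCast, Int.toNat_of_nonneg h2]
    rw [h3]
    exact h1
  · rw [Int.toNat_of_nonpos h2, Nat.cast_zero]
    positivity

/-- A cube of side length `r` contains at most `(N r + 1)ⁿ` points of a translate of the grid. -/
theorem card_filter_gridPoint_le {N : ℕ} (hN : 0 < N) (a x : E n) {r : ℝ} (hr : 0 ≤ r) :
    ((Finset.univ.filter fun m : Fin n → Fin N =>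
      ∀ i, a i < x i + gridPoint N m i ∧ x i + gridPoint N m i < a i + r).card : ℝ)
      ≤ (N * r + 1) ^ n := by
  have h : (Finset.univ.filter fun m : Fin n → Fin N =>
      ∀ i, a i < x i + gridPoint N m i ∧ x i + gridPoint N m i < a i + r) =
      Fintype.piFinset fun i => Finset.univ.filter fun k : Fin N =>
        a i - x i < (k : ℝ) / N ∧ (k : ℝ) / N < a i - x i + r := by
    ext m
    simp only [Finset.mem_filter, Finset.mem_univ, true_and, Fintype.mem_piFinset]
    simp only [gridPoint]
    refine forall_congr' fun i => and_congr ?_ ?_ <;> constructor <;> intro h <;> linarith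
  rw [h, Fintype.card_piFinset, Nat.cast_prod]
  calc _ ≤ ∏ _i : Fin n, ((N : ℝ) * r + 1) :=
        Finset.prod_le_prod (fun _ _ => by positivity) fun i _ => card_filter_grid_le hN _ hr
    _ = _ := by simp

theorem setLIntegral_cube_sum_le {N : ℕ} (hN : 0 < N) (a : E n) {r : ℝ} (hr : 0 ≤ r)
    {w : E n → ℝ≥0∞} (hw : Measurable w) :
    ∫⁻ x in cube a r, ∑ m : Fin n → Fin N, w (x - gridPoint N m)
      ≤ ENNReal.ofReal ((N * r + 1) ^ n) * ∫⁻ x, w x := by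
  classical
  have h1 : ∀ m : Fin n → Fin N, ∫⁻ x in cube a r, w (x - gridPoint N m) =
      ∫⁻ x, (cube a r).indicator 1 (x + gridPoint N m) * w x := fun m => by
    rw [← lintegral_indicator (measurableSet_cube a r),
      ← lintegral_add_right_eq_self _ (gridPoint N m)]
    refine lintegral_congr fun x => ?_
    by_cases hx : x + gridPoint N m ∈ cube a r <;> simp [hx]
  have hind : ∀ m : Fin n → Fin N,
      Measurable fun x => (cube a r).indicator (1 : E n → ℝ≥0∞) (x + gridPoint N m) * w x :=
    fun m => ((measurable_one.indicator (measurableSet_cube a r)).comp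
      (measurable_add_const _)).mul hw
  have hsub : ∀ m : Fin n → Fin N, Measurable fun x => w (x - gridPoint N m) :=
    fun m => hw.comp (measurable_sub_const _)
  rw [lintegral_finsetSum _ fun m _ => hsub m]
  simp_rw [h1]
  rw [← lintegral_finsetSum _ fun m _ => hind m, ← lintegral_const_mul _ hw]
  refine lintegral_mono fun x => ?_
  simp only
  rw [← Finset.sum_mul]
  gcongr
  have h2 : ∀ m : Fin n → Fin N, (cube a r).indicator (1 : E n → ℝ≥0∞) (x + gridPoint N m) =
      if ∀ i, a i < x i + gridPoint N m i ∧ x i + gridPoint N m i < a i + r then 1 else 0 :=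
    fun m => by
      rw [Set.indicator_apply]
      exact if_congr Iff.rfl rfl rfl
  simp_rw [h2]
  rw [Finset.sum_boole, ← ENNReal.ofReal_natCast]
  exact ENNReal.ofReal_le_ofReal (card_filter_gridPoint_le hN a x hr)

/-! ### Sums of weights centred at the grid points -/

/-- The sum of the weights of scale `2⁻ʲ` centred at the points of the grid of mesh size `1 / N`. -/
noncomputable def gridSum (j N : ℕ) (x : E n) : ℝ≥0∞ :=
  ∑ m : Fin n → Fin N, decay (n + 1) (2 ^ j * ‖x - gridPoint N m‖)

theorem measurable_gridSum (j N : ℕ) : Measurable (gridSum (n := n) j N) :=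
  Finset.measurable_sum _ fun _ _ => measurable_decay_comp _ _

theorem lintegral_decay_pow (j : ℕ) (x : E n) :
    ∫⁻ y, decay (n + 1) (2 ^ j * ‖y - x‖)
      = 2 ^ (-(j * n) : ℝ) * decayMass n (n + 1) := by
  rw [lintegral_decay _ _ (by positivity)]
  congr 1
  rw [inv_pow, ← pow_mul, ENNReal.ofReal_inv_of_pos (by positivity),
    ENNReal.ofReal_pow (by positivity), ENNReal.ofReal_ofNat, ENNReal.rpow_neg,
    ← ENNReal.rpow_natCast]
  push_cast
  rfl

theorem setLIntegral_cube_gridSum_le (j : ℕ) {N : ℕ} (hN : 0 < N) (a : E n) {r : ℝ} (hr : 0 ≤ r) :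
    ∫⁻ x in cube a r, gridSum j N x
      ≤ ENNReal.ofReal ((N * r + 1) ^ n) * (2 ^ (-(j * n) : ℝ) * decayMass n (n + 1)) := by
  have h := setLIntegral_cube_sum_le hN a hr (w := fun x => decay (n + 1) (2 ^ j * ‖x‖))
    ((measurable_decay _).comp (by fun_prop))
  refine h.trans_eq ?_
  have h1 := lintegral_decay_pow j (0 : E n)
  simp only [sub_zero] at h1
  rw [h1]

theorem lintegral_gridSum (j N : ℕ) :
    ∫⁻ x : E n, gridSum j N x = (N : ℝ≥0∞) ^ n * (2 ^ (-(j * n) : ℝ) * decayMass n (n + 1)) := by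
  unfold gridSum
  rw [lintegral_finsetSum _ fun m _ => measurable_decay_comp _ _]
  simp_rw [lintegral_decay_pow]
  simp

theorem exists_gridSum_le (n : ℕ) : ∃ C : ℝ≥0∞, C ≠ ∞ ∧ ∀ (j N : ℕ), 0 < N → N ≤ 2 ^ j →
    ∀ x : E n, gridSum j N x ≤ C := by
  refine ⟨ENNReal.ofReal ((1 + n) ^ (n + 1)) * (ENNReal.ofReal (2 ^ n) * decayMass n (n + 1)),
    ?_, fun j N hN hNj x => ?_⟩
  · have := (decayMass_lt_top (n := n) (m := n + 1) (by omega)).ne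
    finiteness
  set r : ℝ := (2 ^ j)⁻¹ with hr_def
  have hr : 0 < r := by positivity
  have hrj : r⁻¹ = 2 ^ j := by rw [hr_def, inv_inv]
  have hNr : N * r ≤ 1 := by
    rw [hr_def, ← div_eq_mul_inv, div_le_one (by positivity)]
    exact_mod_cast hNj
  set a : E n := WithLp.toLp 2 fun i => x i - r / 2 with ha
  have hx : x ∈ cube a r := fun i => by
    simp only [ha]
    constructor <;> linarith
  have h1 : gridSum j N x ≤ ENNReal.ofReal ((1 + n) ^ (n + 1) * r⁻¹ ^ n) *
      ∫⁻ z in cube a r, gridSum j N z := by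
    unfold gridSum
    rw [lintegral_finsetSum _ fun m _ => measurable_decay_comp _ _, Finset.mul_sum, ← hrj]
    exact Finset.sum_le_sum fun m _ => decay_le_average (n + 1) hr hx (gridPoint N m)
  refine (h1.trans (mul_le_mul_right (setLIntegral_cube_gridSum_le j hN a hr.le) _)).trans ?_
  have h2 : ENNReal.ofReal (r⁻¹ ^ n) = 2 ^ (j * n : ℝ) := by
    rw [hrj, ← pow_mul, ENNReal.ofReal_pow (by positivity), ENNReal.ofReal_ofNat,
      ← ENNReal.rpow_natCast]
    push_cast
    rfl
  rw [ENNReal.ofReal_mul (by positivity), h2]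
  calc _ = ENNReal.ofReal ((1 + n) ^ (n + 1)) * (ENNReal.ofReal ((N * r + 1) ^ n) *
        decayMass n (n + 1)) * (2 ^ (j * n : ℝ) * 2 ^ (-(j * n) : ℝ)) := by ring
    _ = ENNReal.ofReal ((1 + n) ^ (n + 1)) * (ENNReal.ofReal ((N * r + 1) ^ n) *
        decayMass n (n + 1)) := by rw [two_rpow_mul_rpow_neg, mul_one]
    _ ≤ _ := by
        gcongr
        linarith

/-! ### The Morrey norms of the wave packets -/

theorem zpow_neg_pow_eq (J : ℤ) : ENNReal.ofReal ((2 ^ (-J)) ^ n) = 2 ^ (-(J * n) : ℝ) := by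
  rw [← zpow_natCast, ← zpow_mul, ← Real.rpow_intCast, ← ENNReal.ofReal_rpow_of_pos two_pos,
    ENNReal.ofReal_ofNat]
  push_cast
  ring_nf

/-- If the grid is not too coarse, the sum of the weights satisfies a Morrey condition of dimension
`n + ϱ`, with a constant proportional to its total mass. -/
theorem exists_setLIntegral_gridSum_le {ϱ : ℝ} (hϱn : -(n : ℝ) < ϱ) (hϱ : ϱ < 0) :
    ∃ C : ℝ≥0∞, C ≠ ∞ ∧ ∀ (j N : ℕ), 0 < N → N ≤ 2 ^ j →
      (2 : ℝ≥0∞) ^ (j * (n + ϱ)) ≤ (N : ℝ≥0∞) ^ n → ∀ (J : ℤ) (M : Fin n → ℤ),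
      2 ^ (J * (n + ϱ)) * ∫⁻ x in dyadicCube J M, gridSum j N x
        ≤ C * ((N : ℝ≥0∞) ^ n * 2 ^ (-(j * n) : ℝ)) := by
  obtain ⟨C₁, hC₁, hpt⟩ := exists_gridSum_le n
  set W := decayMass n (n + 1) with hW
  have hWtop : W ≠ ∞ := (decayMass_lt_top (by omega)).ne
  refine ⟨ENNReal.ofReal (2 ^ n) * W + C₁, by finiteness, fun j N hN hNj hd J M => ?_⟩
  have hN' : (0 : ℝ) < N := by exact_mod_cast hN
  have hJpos : (0 : ℝ) < 2 ^ (-J) := by positivity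
  have h2n : (1 : ℝ≥0∞) ≤ ENNReal.ofReal (2 ^ n) := by
    rw [ENNReal.one_le_ofReal]
    exact one_le_pow₀ one_le_two
  suffices h : 2 ^ (J * (n + ϱ)) * ∫⁻ x in dyadicCube J M, gridSum j N x
      ≤ ENNReal.ofReal (2 ^ n) * W * ((N : ℝ≥0∞) ^ n * 2 ^ (-(j * n) : ℝ)) ∨
      2 ^ (J * (n + ϱ)) * ∫⁻ x in dyadicCube J M, gridSum j N x
      ≤ C₁ * ((N : ℝ≥0∞) ^ n * 2 ^ (-(j * n) : ℝ)) by
    rw [add_mul]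
    rcases h with h | h
    · exact h.trans le_self_add
    · exact h.trans le_add_self
  have hcube : ∫⁻ x in dyadicCube J M, gridSum j N x
      ≤ ENNReal.ofReal ((N * 2 ^ (-J) + 1) ^ n) * (2 ^ (-(j * n) : ℝ) * W) := by
    rw [dyadicCube_eq_cube]
    exact setLIntegral_cube_gridSum_le j hN _ hJpos.le
  rcases le_or_gt J 0 with hJ | hJ
  · -- large cubes: the total mass
    left
    have h1 : (2 : ℝ≥0∞) ^ (J * (n + ϱ)) ≤ 1 := by
      rw [← ENNReal.rpow_zero (x := 2)]
      refine ENNReal.rpow_le_rpow_of_exponent_le one_le_two ?_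
      exact mul_nonpos_of_nonpos_of_nonneg (by exact_mod_cast hJ) (by linarith)
    calc _ ≤ 1 * ∫⁻ x, gridSum j N x := by
          gcongr
          exact Measure.restrict_le_self
      _ = 1 * W * ((N : ℝ≥0∞) ^ n * 2 ^ (-(j * n) : ℝ)) := by rw [lintegral_gridSum]; ring
      _ ≤ _ := by gcongr
  have hJ' : (0 : ℝ) ≤ J := by exact_mod_cast hJ.le
  rcases le_or_gt 1 ((N : ℝ) * 2 ^ (-J)) with h1 | h1
  · -- cubes which are larger than the mesh
    left
    have h2 : (2 : ℝ≥0∞) ^ (J * (n + ϱ)) ≤ 2 ^ (J * n : ℝ) := by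
      refine ENNReal.rpow_le_rpow_of_exponent_le one_le_two ?_
      gcongr
      linarith
    have h3 : ENNReal.ofReal ((N * 2 ^ (-J) + 1) ^ n) ≤
        ENNReal.ofReal (2 ^ n) * ((N : ℝ≥0∞) ^ n * 2 ^ (-(J * n) : ℝ)) := by
      rw [← zpow_neg_pow_eq, ← ENNReal.ofReal_natCast N, ← ENNReal.ofReal_pow (by positivity),
        ← ENNReal.ofReal_mul (by positivity), ← ENNReal.ofReal_mul (by positivity), ← mul_pow,
        ← mul_pow]
      refine ENNReal.ofReal_le_ofReal ?_
      gcongr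
      linarith
    calc _ ≤ 2 ^ (J * n : ℝ) * (ENNReal.ofReal (2 ^ n) * ((N : ℝ≥0∞) ^ n * 2 ^ (-(J * n) : ℝ)) *
          (2 ^ (-(j * n) : ℝ) * W)) := by
          refine mul_le_mul' h2 (hcube.trans ?_)
          gcongr
      _ = ENNReal.ofReal (2 ^ n) * W * ((N : ℝ≥0∞) ^ n * 2 ^ (-(j * n) : ℝ)) *
          (2 ^ (J * n : ℝ) * 2 ^ (-(J * n) : ℝ)) := by ring
      _ = _ := by rw [two_rpow_mul_rpow_neg, mul_one]
  rcases le_or_gt J j with h2 | h2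
  · -- cubes between the scale of the packets and the mesh
    left
    have h3 : (2 : ℝ≥0∞) ^ (J * (n + ϱ)) ≤ (N : ℝ≥0∞) ^ n := by
      refine le_trans (ENNReal.rpow_le_rpow_of_exponent_le one_le_two ?_) hd
      have h4 : (J : ℝ) ≤ j := by exact_mod_cast h2
      exact mul_le_mul_of_nonneg_right h4 (by linarith)
    calc _ ≤ (N : ℝ≥0∞) ^ n * (ENNReal.ofReal (2 ^ n) * (2 ^ (-(j * n) : ℝ) * W)) := by
          refine mul_le_mul' h3 (hcube.trans ?_)
          gcongr
          linarith
      _ = _ := by ring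
  · -- cubes below the scale of the packets
    right
    have h3 : ∫⁻ x in dyadicCube J M, gridSum j N x ≤ C₁ * 2 ^ (-(J * n) : ℝ) := by
      calc _ ≤ ∫⁻ x in dyadicCube J M, C₁ := lintegral_mono fun x => hpt j N hN hNj x
        _ = _ := by
          rw [setLIntegral_const, dyadicCube_eq_cube, volume_cube, ← ENNReal.ofReal_pow hJpos.le,
            zpow_neg_pow_eq]
    calc _ ≤ 2 ^ (J * (n + ϱ)) * (C₁ * 2 ^ (-(J * n) : ℝ)) := by gcongr
      _ = C₁ * 2 ^ (J * ϱ) := by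
        rw [mul_left_comm, ← two_rpow_add]
        ring_nf
      _ ≤ C₁ * 2 ^ (j * ϱ) := by
        gcongr C₁ * ?_
        refine ENNReal.rpow_le_rpow_of_exponent_le one_le_two ?_
        have h4 : (j : ℝ) ≤ J := by exact_mod_cast h2.le
        exact mul_le_mul_of_nonpos_right h4 hϱ.le
      _ = C₁ * (2 ^ (j * (n + ϱ)) * 2 ^ (-(j * n) : ℝ)) := by
        rw [← two_rpow_add]
        ring_nf
      _ ≤ _ := by gcongr

theorem decay_rpow_le {p : ℝ} (hp : 0 < p) {K m : ℕ} (hK : (m : ℝ) ≤ K * p) {t : ℝ} (ht : 0 ≤ t) :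
    decay K t ^ p ≤ decay m t := by
  rw [decay, decay, ENNReal.ofReal_rpow_of_nonneg (by positivity) hp.le]
  refine ENNReal.ofReal_le_ofReal ?_
  rw [Real.inv_rpow (by positivity), ← Real.rpow_natCast, ← Real.rpow_natCast (1 + t) m,
    ← Real.rpow_mul (by positivity)]
  gcongr
  linarith

theorem sum_rpow_le_sum_rpow {ι : Type*} (s : Finset ι) (a : ι → ℝ≥0∞) {p : ℝ} (hp : 0 < p)
    (hp1 : p ≤ 1) : (∑ i ∈ s, a i) ^ p ≤ ∑ i ∈ s, a i ^ p := by
  classical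
  induction s using Finset.induction_on with
  | empty => simp [hp]
  | insert i s hi ih =>
    rw [Finset.sum_insert hi, Finset.sum_insert hi]
    exact (ENNReal.rpow_add_le_add_rpow _ _ hp.le hp1).trans (by gcongr)

/-- The `p`-th power of the sum of rapidly decaying weights is dominated by a sum of weights. -/
theorem exists_sum_decay_rpow_le (n : ℕ) {p : ℝ} (hp : 0 < p) :
    ∃ (K : ℕ) (C : ℝ≥0∞), C ≠ ∞ ∧ ∀ (j N : ℕ), 0 < N → N ≤ 2 ^ j → ∀ x : E n,
      (∑ m : Fin n → Fin N, decay K (2 ^ j * ‖x - gridPoint N m‖)) ^ p ≤ C * gridSum j N x := by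
  rcases le_or_gt 1 p with hp1 | hp1
  · obtain ⟨C, hC, h⟩ := exists_gridSum_le n
    refine ⟨n + 1, C ^ (p - 1), ENNReal.rpow_ne_top_of_nonneg (by linarith) hC,
      fun j N hN hNj x => ?_⟩
    change gridSum j N x ^ p ≤ _
    calc gridSum j N x ^ p = gridSum j N x ^ (p - 1) * gridSum j N x := by
          have h2 := ENNReal.rpow_add_of_nonneg (x := gridSum j N x) (p - 1) 1 (by linarith)
            zero_le_one
          rwa [ENNReal.rpow_one, sub_add_cancel] at h2
      _ ≤ _ := mul_le_mul_left (ENNReal.rpow_le_rpow (h j N hN hNj x) (by linarith)) _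
  · obtain ⟨K, hK⟩ := exists_nat_ge (((n + 1 : ℕ) : ℝ) / p)
    refine ⟨K, 1, ENNReal.one_ne_top, fun j N _ _ x => ?_⟩
    rw [one_mul]
    refine (sum_rpow_le_sum_rpow _ _ hp hp1.le).trans (Finset.sum_le_sum fun m _ => ?_)
    exact decay_rpow_le hp ((div_le_iff₀ hp).1 hK) (by positivity)

/-- The Morrey norms of the blocks of the superposition of wave packets. -/
theorem exists_morreyNorm_block_le {φ₀ : 𝓢(E n, ℂ)} (hφ₀ : IsGenerator φ₀) {e : E n}
    (he : ‖e‖ = 1) {p ϱ : ℝ} (hp : 0 < p) (hϱn : -(n : ℝ) < ϱ) (hϱ : ϱ < 0) {N : ℕ → ℕ}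
    (hN : ∀ j, 0 < N j) (hNj : ∀ j, N j ≤ 2 ^ j)
    (hd : ∀ j : ℕ, (2 : ℝ≥0∞) ^ (j * (n + ϱ)) ≤ (N j : ℝ≥0∞) ^ n) {σ : ℝ} {B : ℝ≥0∞} (hB : B ≠ ∞)
    (hσ : ∀ j : ℕ, ((N j : ℝ≥0∞) ^ n * 2 ^ (-(j * n) : ℝ)) ^ (1 - p) ≤ B * 2 ^ (-(j * σ * p)))
    {f : 𝓢'(E n, ℂ)} (hf : ∀ ψ, f ψ = ∫ η, packetSum φ₀ e N η * 𝓕⁻ ψ η) :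
    ∃ C : ℝ≥0∞, C ≠ ∞ ∧
      ∀ j : ℕ, morreyNorm ϱ p (fun x => ‖block φ₀ f j x‖ₑ) ≤ C * 2 ^ (-(j * σ)) := by
  obtain ⟨K, C₁, hC₁, hsum⟩ := exists_sum_decay_rpow_le n hp
  obtain ⟨C₂, hC₂, hV⟩ := exists_fourierInv_bump_bound φ₀ K
  obtain ⟨C₃, hC₃, hgrid⟩ := exists_setLIntegral_gridSum_le hϱn hϱ
  set A : ℝ≥0∞ := ENNReal.ofReal C₂ ^ p * C₁ * C₃ * B with hA
  have hAtop : A ≠ ∞ := by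
    have : ENNReal.ofReal C₂ ^ p ≠ ∞ := ENNReal.rpow_ne_top_of_nonneg hp.le ENNReal.ofReal_ne_top
    finiteness
  refine ⟨A ^ (1 / p), ENNReal.rpow_ne_top_of_nonneg (by positivity) hAtop, fun j => ?_⟩
  -- the number of packets relative to the number of dyadic cubes of side length `2⁻ʲ`
  set ν : ℝ≥0∞ := (N j : ℝ≥0∞) ^ n * 2 ^ (-(j * n) : ℝ) with hν
  have hν0 : ν ≠ 0 := by
    refine mul_ne_zero (pow_ne_zero _ (by exact_mod_cast (hN j).ne')) ?_
    rw [ne_eq, ENNReal.rpow_eq_zero_iff]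
    simp
  have hνtop : ν ≠ ∞ := ENNReal.mul_ne_top (by finiteness) (two_rpow_ne_top _)
  have hpt : ∀ x, ‖block φ₀ f j x‖ₑ ^ p ≤
      (ENNReal.ofReal C₂ * ν⁻¹) ^ p * (C₁ * gridSum j (N j) x) := by
    intro x
    refine le_trans ?_ (mul_le_mul_right (hsum j (N j) (hN j) (hNj j) x) _)
    rw [← ENNReal.mul_rpow_of_nonneg _ _ hp.le]
    refine ENNReal.rpow_le_rpow ?_ hp.le
    have h1 : ‖block φ₀ f j x‖ₑ = ((N j : ℝ≥0∞) ^ n)⁻¹ *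
        ‖∑ m : Fin n → Fin (N j), 𝓕⁻ (bump φ₀ j) (x - gridPoint (N j) m)‖ₑ := by
      have h0 : ‖((N j : ℂ) ^ n)⁻¹‖ₑ = ((N j : ℝ≥0∞) ^ n)⁻¹ := by
        rw [← ofReal_norm, norm_inv, norm_pow, Complex.norm_natCast, ENNReal.ofReal_inv_of_pos
          (pow_pos (by exact_mod_cast hN j) n), ENNReal.ofReal_pow (by positivity),
          ENNReal.ofReal_natCast]
      rw [← h0, ← enorm_mul, ← ofReal_norm, norm_block_of_fourier_eq_packetSum hφ₀ he hf,
        ofReal_norm]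
    have h2 : ENNReal.ofReal (C₂ * (2 ^ j) ^ n) = ENNReal.ofReal C₂ * 2 ^ (j * n : ℝ) := by
      rw [ENNReal.ofReal_mul hC₂, ← pow_mul, ENNReal.ofReal_pow (by positivity),
        ENNReal.ofReal_ofNat, ← ENNReal.rpow_natCast]
      push_cast
      rfl
    have h3 : ν⁻¹ = ((N j : ℝ≥0∞) ^ n)⁻¹ * 2 ^ (j * n : ℝ) := by
      rw [hν, ENNReal.mul_inv (Or.inr (two_rpow_ne_top _)) (Or.inl (by finiteness)),
        ← ENNReal.rpow_neg, neg_neg]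
    rw [h1, h3]
    calc _ ≤ ((N j : ℝ≥0∞) ^ n)⁻¹ * ∑ m : Fin n → Fin (N j),
          ENNReal.ofReal (C₂ * (2 ^ j) ^ n) * decay K (2 ^ j * ‖x - gridPoint (N j) m‖) := by
          gcongr
          refine (enorm_sum_le _ _).trans (Finset.sum_le_sum fun m _ => ?_)
          exact enorm_le_mul_decay (by positivity) (hV j _)
      _ = _ := by
          rw [← Finset.mul_sum, h2]
          ring
  refine iSup₂_le fun J M => ?_
  have h1 : (morreyWeight n ϱ p J * lpNormOn p (dyadicCube J M) fun x => ‖block φ₀ f j x‖ₑ) ^ p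
      ≤ A * 2 ^ (-(j * σ * p)) := by
    have h2 : (morreyWeight n ϱ p J * lpNormOn p (dyadicCube J M) fun x => ‖block φ₀ f j x‖ₑ) ^ p
        = 2 ^ (J * (n + ϱ)) * ∫⁻ x in dyadicCube J M, ‖block φ₀ f j x‖ₑ ^ p := by
      have h3 := morreyWeight_mul_lpNormOn_rpow (s := 0) (ϱ := ϱ) (φ₀ := φ₀) hp f J
        (dyadicCube J M) j
      have h4 : wblock φ₀ 0 f j = fun x => ‖block φ₀ f j x‖ₑ := by
        ext x
        simp [wblock]
      rw [h4] at h3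
      simpa using h3
    have hνp : (ν⁻¹) ^ p * ν = ν ^ (1 - p) := by
      rw [ENNReal.inv_rpow, ← ENNReal.rpow_neg]
      have h4 := ENNReal.rpow_add (-p) 1 hν0 hνtop
      rw [ENNReal.rpow_one] at h4
      rw [← h4]
      ring_nf
    rw [h2]
    calc _ ≤ 2 ^ (J * (n + ϱ)) * ∫⁻ x in dyadicCube J M,
          (ENNReal.ofReal C₂ * ν⁻¹) ^ p * (C₁ * gridSum j (N j) x) := by
          gcongr with x
          exact hpt x
      _ = (ENNReal.ofReal C₂ * ν⁻¹) ^ p * C₁ *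
          (2 ^ (J * (n + ϱ)) * ∫⁻ x in dyadicCube J M, gridSum j (N j) x) := by
          rw [lintegral_const_mul _ ((measurable_gridSum j (N j)).const_mul _),
            lintegral_const_mul _ (measurable_gridSum j (N j))]
          ring
      _ ≤ (ENNReal.ofReal C₂ * ν⁻¹) ^ p * C₁ * (C₃ * ν) :=
          mul_le_mul_right (hgrid j (N j) (hN j) (hNj j) (hd j) J M) _
      _ = ENNReal.ofReal C₂ ^ p * C₁ * C₃ * ν ^ (1 - p) := by
          rw [ENNReal.mul_rpow_of_nonneg _ _ hp.le, ← hνp]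
          ring
      _ ≤ ENNReal.ofReal C₂ ^ p * C₁ * C₃ * (B * 2 ^ (-(j * σ * p))) := by
          gcongr
          exact hσ j
      _ = _ := by rw [hA]; ring
  calc _ = ((morreyWeight n ϱ p J *
        lpNormOn p (dyadicCube J M) fun x => ‖block φ₀ f j x‖ₑ) ^ p) ^ (1 / p) := by
        rw [← ENNReal.rpow_mul, mul_one_div_cancel hp.ne', ENNReal.rpow_one]
    _ ≤ (A * 2 ^ (-(j * σ * p))) ^ (1 / p) := by gcongr
    _ = _ := by
        rw [ENNReal.mul_rpow_of_nonneg _ _ (by positivity), ← ENNReal.rpow_mul]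
        congr 2
        field_simp

/-! ### The choice of the grids -/

/-- For `p ≥ 1` all dyadic cubes of side length `2⁻ʲ` carry a packet. For `p < 1` the packets are as
sparse as the Morrey condition permits: about `2^{j (n + ϱ)}` of them at frequency `2^j`. -/
theorem exists_grid {p ϱ : ℝ} (hp : 0 < p) (hϱn : -(n : ℝ) < ϱ) (hϱ : ϱ < 0) :
    ∃ (N : ℕ → ℕ) (B : ℝ≥0∞), B ≠ ∞ ∧ (∀ j, 0 < N j) ∧ (∀ j, N j ≤ 2 ^ j) ∧
      (∀ j : ℕ, (2 : ℝ≥0∞) ^ (j * (n + ϱ)) ≤ (N j : ℝ≥0∞) ^ n) ∧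
      ∀ j : ℕ, ((N j : ℝ≥0∞) ^ n * 2 ^ (-(j * n) : ℝ)) ^ (1 - p)
        ≤ B * 2 ^ (-(j * sigma |ϱ| p * p)) := by
  have hn : (0 : ℝ) < n := by linarith
  rcases le_or_gt 1 p with hp1 | hp1
  · have hσ : sigma |ϱ| p = 0 := by
      rw [sigma, max_eq_right ((div_le_one hp).2 hp1), sub_self, mul_zero]
    have hpow : ∀ j : ℕ, (((2 ^ j : ℕ) : ℝ≥0∞)) ^ n = 2 ^ (j * n : ℝ) := fun j => by
      push_cast
      rw [← pow_mul, ← ENNReal.rpow_natCast]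
      push_cast
      rfl
    refine ⟨fun j => 2 ^ j, 1, ENNReal.one_ne_top, fun j => by positivity, fun j => le_rfl,
      fun j => ?_, fun j => ?_⟩
    · rw [hpow]
      refine ENNReal.rpow_le_rpow_of_exponent_le one_le_two ?_
      gcongr
      linarith
    · rw [hpow, two_rpow_mul_rpow_neg, hσ]
      simp
  · have hσ : sigma |ϱ| p * p = -ϱ * (1 - p) := by
      rw [sigma, max_eq_left ((one_le_div hp).2 hp1.le), abs_of_neg hϱ]
      field_simp
    have h1 : ∀ j : ℕ, (1 : ℝ) ≤ 2 ^ (j * (n + ϱ) / n : ℝ) := fun j =>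
      Real.one_le_rpow one_le_two (div_nonneg (mul_nonneg (by positivity) (by linarith)) hn.le)
    have hpow : ∀ j : ℕ, ENNReal.ofReal (2 ^ (j * (n + ϱ) / n : ℝ)) ^ n
        = 2 ^ (j * (n + ϱ) : ℝ) := fun j => by
      rw [← ENNReal.ofReal_rpow_of_pos two_pos, ENNReal.ofReal_ofNat, ← ENNReal.rpow_mul_natCast,
        div_mul_cancel₀ _ hn.ne']
    refine ⟨fun j => ⌈(2 : ℝ) ^ (j * (n + ϱ) / n : ℝ)⌉₊, (2 ^ n) ^ (1 - p),
      ENNReal.rpow_ne_top_of_nonneg (by linarith) (by finiteness),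
      fun j => Nat.ceil_pos.2 (by linarith [h1 j]), fun j => ?_, fun j => ?_, fun j => ?_⟩
    · rw [Nat.ceil_le]
      push_cast
      rw [← Real.rpow_natCast]
      refine Real.rpow_le_rpow_of_exponent_le one_le_two ?_
      rw [div_le_iff₀ hn]
      gcongr
      linarith
    · rw [← hpow, ← ENNReal.ofReal_natCast]
      gcongr
      exact Nat.le_ceil _
    · have h2 : ((⌈(2 : ℝ) ^ (j * (n + ϱ) / n : ℝ)⌉₊ : ℕ) : ℝ≥0∞) ≤
          2 * ENNReal.ofReal (2 ^ (j * (n + ϱ) / n : ℝ)) := by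
        rw [← ENNReal.ofReal_natCast, ← ENNReal.ofReal_ofNat, ← ENNReal.ofReal_mul two_pos.le]
        refine ENNReal.ofReal_le_ofReal ?_
        linarith [h1 j, Nat.ceil_lt_add_one (zero_le_one.trans (h1 j))]
      calc _ ≤ ((2 * ENNReal.ofReal (2 ^ (j * (n + ϱ) / n : ℝ))) ^ n *
            2 ^ (-(j * n) : ℝ)) ^ (1 - p) := by
            refine ENNReal.rpow_le_rpow ?_ (by linarith)
            gcongr
        _ = (2 ^ n * (2 ^ (j * ϱ) : ℝ≥0∞)) ^ (1 - p) := by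
            rw [mul_pow, hpow, mul_assoc, ← two_rpow_add]
            ring_nf
        _ = (2 ^ n) ^ (1 - p) * 2 ^ (-(j * sigma |ϱ| p * p)) := by
            rw [ENNReal.mul_rpow_of_nonneg _ _ (by linarith), ← ENNReal.rpow_mul, mul_assoc _ _ p,
              hσ]
            ring_nf

/-- Below the critical smoothness all spaces of the clan contain a common distribution which is not
locally integrable. -/
theorem exists_mem_clan_notMem_L1loc {φ₀ : 𝓢(E n, ℂ)} (hφ₀ : IsGenerator φ₀) {s p ϱ : ℝ}
    {q : ℝ≥0∞} (hp : 0 < p) (hq : 0 < q) (hϱn : -(n : ℝ) < ϱ) (hϱ : ϱ < 0)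
    (hs : s < sigma |ϱ| p) : ∃ f, f ∉ L1loc n ∧ ∀ X ∈ clan n φ₀ ϱ s p q, f ∈ X := by
  have hn : 0 < n := by
    have : (0 : ℝ) < n := by linarith
    exact_mod_cast this
  obtain ⟨e, he⟩ : ∃ e : E n, ‖e‖ = 1 :=
    ⟨EuclideanSpace.single (⟨0, hn⟩ : Fin n) (1 : ℝ), by simp⟩
  obtain ⟨N, B, hB, hN, hNj, hd, hσ⟩ := exists_grid hp hϱn hϱ
  obtain ⟨D, hD⟩ := exists_packetSum_bound hφ₀ he hN
  obtain ⟨f, hf⟩ := exists_fourier_eq_of_bounded (measurable_packetSum φ₀ e N) hD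
  obtain ⟨C, hC, h⟩ := exists_morreyNorm_block_le hφ₀ he hp hϱn hϱ hN hNj hd hB hσ hf
  exact ⟨f, notMem_L1loc_of_fourier_eq_packetSum hφ₀ he hN hf,
    fun X hX => mem_of_morreyNorm_block_le hp hq hs hC h hX⟩

end MorreySmoothness

open MorreySmoothness in
theorem theorem5p7 (n : ℕ) (φ₀ : 𝓢(E n, ℂ)) (hφ₀ : IsGenerator φ₀)
    (s p ϱ : ℝ) (q : ℝ≥0∞) (hp : 0 < p) (hq : 0 < q) (hϱn : -(n : ℝ) < ϱ) (hϱ : ϱ < 0) :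
    (sigma |ϱ| p < s → ∀ X ∈ clan n φ₀ ϱ s p q, X ⊆ L1loc n) ∧
      (s < sigma |ϱ| p → ∀ X ∈ clan n φ₀ ϱ s p q, ¬ X ⊆ L1loc n) := by
  refine ⟨fun hs X hX => clan_subset_L1loc hφ₀ hp hq hϱ hs hX, fun hs X hX h => ?_⟩
  obtain ⟨f, hf, hmem⟩ := exists_mem_clan_notMem_L1loc hφ₀ hp hq hϱn hϱ hs
  exact hf (h (hmem X hX))
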